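/- A juggling pattern is a bijection $f:\mathbb Z\to\mathbb Z$ such that $df(t):=f(t)-t\ge 0$ for all $t$ and $df$ is periodic; a ball thrown at beat $t$ is caught at beat $f(t)$, and nothing is thrown at $t$ if $df(t)=0$. The balls are the orbits of $f$ that are not fixed points; let $n$ be their number. Given a carry value $c>0$ and a dwell value $d>0$, the balls move as follows. Each ball is caught at time $t-d/2$ and thrown at time $t+d/2$ for each of its beats $t$. One hand, used on even beats, catches at position $0$ and throws from position $c$; the other hand, used on odd beats, catches at position $1$ and throws from position $1-c$. Between these times the position changes linearly. The height is $0$ during a carry and is $(s-t-d/2)(f(t)-d/2-s)$ at time $s$ in the flight after a throw at beat $t$ (so the maximal height is proportional to the square of the time of flight). The positions as functions of time form a diagram of $n$ strands; at a crossing the strand of the higher ball passes over. Let $m$ be the least period of $df$. A fundamental chamber is a time interval of length $2m$ if $m$ is odd and of length $m$ if $m$ is even. Let $B_n$ be Artin's braid group on $n$ strands, with generators $\sigma_1,\dots,\sigma_{n-1}$, where in $\sigma_i$ the strand at position $i$ crosses over that at position $i+1$. A solid torus braid is a conjugacy class of some $B_n$, $n\ge 0$. Let $\mathcal J(f)$ be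 the solid torus braid obtained by closing a fundamental chamber of the braid diagram of $f$, that is, the conjugacy class in $B_n$ of the word of its crossings in the order of time, for all sufficiently small $c,d>0$. Theorem. The map $\mathcal J$ is surjective: for every solid torus braid $\beta$ there are a juggling pattern $f$ and a $\delta>0$ such that for all $c,d\in(0,\delta)$ the balls do not collide and the closure of a fundamental chamber of the braid diagram of $f$ is $\beta$. -/

import Mathlib

open Filter Topology

/-! ### Braid groups and solid torus braids -/

/-- The relators of Artin's presentation of the braid group on `n` strands. The generator with
index `i` (counted from `0`) crosses the strands at the positions `i` and `i + 1`. -/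
def artinRelators (n : ℕ) : Set (FreeGroup (Fin (n - 1))) :=
  {r | ∃ i j : Fin (n - 1), (i : ℕ) + 1 = j ∧
      r = FreeGroup.of i * FreeGroup.of j * FreeGroup.of i *
        (FreeGroup.of j * FreeGroup.of i * FreeGroup.of j)⁻¹} ∪
  {r | ∃ i j : Fin (n - 1), (i : ℕ) + 1 < j ∧
      r = FreeGroup.of i * FreeGroup.of j * (FreeGroup.of j * FreeGroup.of i)⁻¹}

/-- The braid group on `n` strands. -/
abbrev BraidGroup (n : ℕ) : Type := PresentedGroup (artinRelators n)

/-- The generator in which the strand at position `i` crosses over the strand at position `i + 1`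
(positions are counted from `0`, so that `i + 1 < n` is meant). -/
def braidGen (n i : ℕ) : BraidGroup n :=
  if h : i < n - 1 then PresentedGroup.of ⟨i, h⟩ else 1

/-- The braid spelled by a word. The letter `(i, true)` is the crossing in which the strand at
position `i` passes over the strand at position `i + 1`; in `(i, false)` it passes under. -/
def braidOfWord (n : ℕ) (w : List (ℕ × Bool)) : BraidGroup n :=
  (w.map fun p => if p.2 then braidGen n p.1 else (braidGen n p.1)⁻¹).prod

/-- Solid torus braids: closed braids in the solid torus, that is, braids on any number of strands
up to conjugation. -/
abbrev SolidTorusBraid : Type := Σ n : ℕ, ConjClasses (BraidGroup n)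

/-! ### Reading crossings

While a set of strands passes from one order of positions to another, each pair of strands that
changes its order crosses once. -/

section Crossings

variable {α : Type*}

open scoped Classical in
/-- The strand `x`, at position `p`, followed by the strands of a list at the positions
`p + 1, p + 2, …`, crosses these strands one after the other until it has reached its place with
respect to the order `r`. The value is the new list, and the word of the crossings;
`ov x y` says that `x` passes over `y`. -/
noncomputable def moveStrand (r ov : α → α → Prop) : ℕ → α → List α → List α × List (ℕ × Bool)
  | _, x, [] => ([x], [])
  | p, x, y :: l =>
    if r x y then (x :: y :: l, [])
    else
      let q := moveStrand r ov (p + 1) x l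
      (y :: q.1, (p, decide (ov x y)) :: q.2)

/-- Strands that lie in the order of a given list, at the positions `p, p + 1, …`, are brought into
the order `r` by crossings of neighbours. The value is the new list, and the word of the
crossings. -/
noncomputable def sortStrands (r ov : α → α → Prop) : ℕ → List α → List α × List (ℕ × Bool)
  | _, [] => ([], [])
  | p, x :: l =>
    let q := sortStrands r ov (p + 1) l
    let q' := moveStrand r ov p x q.1
    (q'.1, q.2 ++ q'.2)

open scoped Classical in
/-- All the elements of a finite type, listed in the strict linear order `r`. -/
noncomputable def orderedList (r : α → α → Prop) : List α :=
  if h : ∃ l : List α, l.Nodup ∧ (∀ a, a ∈ l) ∧ l.Pairwise r then h.choose else []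

end Crossings

/-! ### Juggling patterns -/

/-- A juggling pattern: a bijection of `ℤ` whose throw values `f t - t` are nonnegative and
periodic. A ball thrown at beat `t` is caught at beat `f t`; nothing is thrown at `t` if
`f t = t`. -/
structure JugglingPattern where
  /-- the bijection -/
  f : Equiv.Perm ℤ
  le_apply : ∀ t, t ≤ f t
  periodic : ∃ n : ℕ, 0 < n ∧ ∀ t, f (t + n) - (t + n) = f t - t

namespace JugglingPattern

variable (P : JugglingPattern)

/-- The exact (least) period of a pattern. -/
noncomputable def exactPeriod : ℕ :=
  sInf {m : ℕ | 0 < m ∧ ∀ t, P.f (t + m) - (t + m) = P.f t - t}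

open scoped Classical in
/-- The length of a fundamental chamber: the exact period, doubled if it is odd since the hands
alternate. -/
noncomputable def chamberLength : ℕ :=
  if Odd P.exactPeriod then 2 * P.exactPeriod else P.exactPeriod

/-- The balls of a pattern are the orbits of `f` other than the fixed points (the `0`-throws); a
ball is given by the set of the beats at which it is thrown. -/
def Ball : Type :=
  {B : Set ℤ // ∃ t, P.f t ≠ t ∧ B = {u | P.f.SameCycle t u}}

/-! ### The motion of the balls

The hand of the even beats reaches from `0` (outside) to `c` (inside), that of the odd beats from
`1` (outside) to `1 - c` (inside). A ball is caught on the outside at time `t - d / 2`, carried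
inwards until time `t + d / 2`, and then thrown from the inside. Here `c` is the carry value and
`d` the dwell value. -/

open scoped Classical in
/-- The outside of the hand that acts at beat `t`. -/
noncomputable def outside (t : ℤ) : ℝ := if Even t then 0 else 1

open scoped Classical in
/-- The inside of the hand that acts at beat `t`. -/
noncomputable def inside (c : ℝ) (t : ℤ) : ℝ := if Even t then c else 1 - c

variable {P}

/-- The last beat at which the ball `b` has been caught by time `s`. -/
noncomputable def lastBeat (d : ℝ) (b : P.Ball) (s : ℝ) : ℤ :=
  sSup {t : ℤ | t ∈ b.1 ∧ (t : ℝ) - d / 2 ≤ s}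

open scoped Classical in
/-- The position of the ball `b` between the hands at time `s`: the strand of `b` in the ladder
diagram. -/
noncomputable def position (c d : ℝ) (b : P.Ball) (s : ℝ) : ℝ :=
  let t := lastBeat d b s
  if s ≤ t + d / 2 then
    AffineMap.lineMap (outside t) (inside c t) ((s - (t - d / 2)) / d)
  else
    AffineMap.lineMap (inside c t) (outside (P.f t))
      ((s - (t + d / 2)) / ((P.f t - d / 2) - (t + d / 2)))

open scoped Classical in
/-- The height of the ball `b` at time `s`, in units of half the gravitational acceleration. It is
`0` while the ball is carried, and parabolic in flight, so that the greatest height of a throw is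
proportional to the square of the time of flight. -/
noncomputable def height (d : ℝ) (b : P.Ball) (s : ℝ) : ℝ :=
  let t := lastBeat d b s
  if s ≤ t + d / 2 then 0 else (s - (t + d / 2)) * ((P.f t - d / 2) - s)

/-- `a` is at a smaller position than `b` just before time `t`. -/
def LtBefore (c d t : ℝ) (a b : P.Ball) : Prop :=
  ∀ᶠ s in 𝓝[<] t, position c d a s < position c d b s

/-- `a` is at a smaller position than `b` just after time `t`. -/
def LtAfter (c d t : ℝ) (a b : P.Ball) : Prop :=
  ∀ᶠ s in 𝓝[>] t, position c d a s < position c d b s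

/-- At time `t` the ball `a` is above the ball `b`. -/
def IsAbove (d t : ℝ) (a b : P.Ball) : Prop := height d b t < height d a t

variable (P)

/-- No two balls are ever at the same place. -/
def CollisionFree (c d : ℝ) : Prop :=
  ∀ (s : ℝ) (a b : P.Ball), a ≠ b → position c d a s = position c d b s →
    height d a s ≠ height d b s

/-- The crossings of the braid diagram at time `t`: the word that leads from the order of the balls
just before `t` to that just after `t`, where the ball that is higher at time `t` passes over. -/
noncomputable def crossingsAt (c d t : ℝ) : List (ℕ × Bool) :=
  (sortStrands (LtAfter (P := P) c d t) (IsAbove d t) 0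
    (orderedList (LtBefore (P := P) c d t))).2

/-- The times in a fundamental chamber at which there is a crossing in the ladder diagram. -/
def crossingTimes (c d : ℝ) : Set ℝ :=
  {t | 0 ≤ t ∧ t < P.chamberLength ∧
    ∃ a b : P.Ball, a ≠ b ∧ position c d a t = position c d b t}

open scoped Classical in
/-- The word of a fundamental chamber of the braid diagram, read in the order of time. -/
noncomputable def chamberWord (c d : ℝ) : List (ℕ × Bool) :=
  if h : (P.crossingTimes c d).Finite then
    (h.toFinset.sort (· ≤ ·)).flatMap (P.crossingsAt c d)
  else []

/-- The closure of a fundamental chamber of the braid diagram with carry value `c` and dwell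
value `d`. -/
noncomputable def closedBraid (c d : ℝ) : SolidTorusBraid :=
  ⟨Nat.card P.Ball, ConjClasses.mk (braidOfWord (Nat.card P.Ball) (P.chamberWord c d))⟩

/-- The graph of the map `𝒥` from juggling patterns to solid torus braids: for all sufficiently
small carry and dwell values, the balls do not collide and the closure of a fundamental chamber of
the braid diagram is `β`. -/
def JMapsTo (β : SolidTorusBraid) : Prop :=
  ∃ δ : ℝ, 0 < δ ∧ ∀ c d : ℝ, 0 < c → c < δ → 0 < d → d < δ →
    P.CollisionFree c d ∧ P.closedBraid c d = β

variable {P}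

/-- `𝒥` is single-valued. -/
theorem JMapsTo.unique {β γ : SolidTorusBraid} (h : P.JMapsTo β) (h' : P.JMapsTo γ) : β = γ := by
  obtain ⟨δ, hδ, h⟩ := h
  obtain ⟨ε, hε, h'⟩ := h'
  have hm : 0 < min δ ε := lt_min hδ hε
  have h1 : min δ ε / 2 < δ := lt_of_lt_of_le (half_lt_self hm) (min_le_left _ _)
  have h2 : min δ ε / 2 < ε := lt_of_lt_of_le (half_lt_self hm) (min_le_right _ _)
  rw [← (h _ _ (half_pos hm) h1 (half_pos hm) h1).2, ← (h' _ _ (half_pos hm) h2 (half_pos hm) h2).2]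

end JugglingPattern

/-! ### Layered braids -/

/-! A conjugacy class is represented by a word `w` in the generators, and a pattern is built that
performs `w` letter by letter. The `n` balls travel together from hand to hand in rounds. Flights
are long compared with the `2 * n` beats in which the balls of a round are thrown, so a round splits
into two time windows: one in which all balls fly in the same direction, and a change of hands,
where some balls are already thrown while others are still arriving.

In either window the heights at meetings follow one fixed linear order of the balls, as if each ball
moved in its own layer. The braid then depends only on the orders of positions at the two ends: it
is a quotient of two permutation braids (`layerBraid_sortStrands`, `braidAtTimes_eq_of_layers`). In
common flight, balls meet at equal fractions `f` of their flights of lengths `l`, at heights `f * (1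
- f) * l ^ 2`; the ball thrown earlier has the longer flight and is above (`height_lt_of_meet_mid`).
At a change of hands, two balls meet at nearly equal fractions from the wall if the carry is small,
so again the longer flight is above. Flight times of consecutive rounds differ by at least 6, so it
is always the outgoing or always the incoming ball that is above (`height_lt_of_meet_turn`). All
pairs cross, and the braid is a half twist Δ or its inverse; the sign depends on the hand and on
whether the flight time grows.

Flight times grow at all changes of hands of a period except the last two. The changes therefore
read Δ, Δ⁻¹, …, Δ, Δ⁻¹ and finally Δ⁻¹, Δ. Exchanging two neighbouring balls in flight gives a
negative letter in an even round and a positive one in an odd round. With x and y the letters of two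
consecutive rounds, the second mirrored by conjugation with Δ, these rounds give x Δ (Δ⁻¹ y Δ) Δ⁻¹ =
x y, so each letter of `w` can be produced with everything else cancelling (`prod_rounds`).

A fundamental chamber is defined by the least period, so one pass through the word must be the least
period. This holds because the longest throw value occurs in one round of a pass only
(`exactPeriod_wordSchedule`). -/

theorem braidGen_of_le {n i : ℕ} (h : n ≤ i + 1) : braidGen n i = 1 :=
  dif_neg (by omega)

theorem braidGen_comm {n i j : ℕ} (hij : i + 1 < j) :
    braidGen n i * braidGen n j = braidGen n j * braidGen n i := by
  unfold braidGen
  by_cases hj : j < n - 1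
  · have hi : i < n - 1 := by omega
    rw [dif_pos hi, dif_pos hj]
    have := PresentedGroup.one_of_mem (rels := artinRelators n)
      (x := FreeGroup.of ⟨i, hi⟩ * FreeGroup.of ⟨j, hj⟩ *
        (FreeGroup.of ⟨j, hj⟩ * FreeGroup.of ⟨i, hi⟩)⁻¹) (Or.inr ⟨⟨i, hi⟩, ⟨j, hj⟩, hij, rfl⟩)
    rw [map_mul, map_inv, mul_inv_eq_one, map_mul, map_mul] at this
    exact this
  · simp [hj]

theorem braidGen_braid {n i : ℕ} (h : i + 2 < n) :
    braidGen n i * braidGen n (i + 1) * braidGen n i =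
      braidGen n (i + 1) * braidGen n i * braidGen n (i + 1) := by
  unfold braidGen
  have hi : i < n - 1 := by omega
  have hj : i + 1 < n - 1 := by omega
  rw [dif_pos hi, dif_pos hj]
  have := PresentedGroup.one_of_mem (rels := artinRelators n) (Or.inl ⟨⟨i, hi⟩, ⟨i + 1, hj⟩, rfl, rfl⟩)
  rw [map_mul, map_inv, mul_inv_eq_one] at this
  simp only [map_mul] at this
  exact this

/-- The braid of a single crossing. -/
def braidLetter (n i : ℕ) (b : Bool) : BraidGroup n :=
  if b then braidGen n i else (braidGen n i)⁻¹

theorem braidLetter_of_le {n i : ℕ} (h : n ≤ i + 1) (b : Bool) : braidLetter n i b = 1 := by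
  cases b <;> simp [braidLetter, braidGen_of_le h]

@[simp] theorem braidOfWord_nil (n : ℕ) : braidOfWord n [] = 1 := rfl

@[simp] theorem braidOfWord_cons (n : ℕ) (x : ℕ × Bool) (w : List (ℕ × Bool)) :
    braidOfWord n (x :: w) = braidLetter n x.1 x.2 * braidOfWord n w := by
  simp [braidOfWord, braidLetter]

@[simp] theorem braidOfWord_append (n : ℕ) (v w : List (ℕ × Bool)) :
    braidOfWord n (v ++ w) = braidOfWord n v * braidOfWord n w := by
  simp [braidOfWord]

/-! ### Sorting words and the permutation braids of layers -/

section Sorting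

variable {α β : Type*}

theorem moveStrand_perm (r ov : α → α → Prop) (p : ℕ) (x : α) (l : List α) :
    (moveStrand r ov p x l).1.Perm (x :: l) := by
  induction l generalizing p with
  | nil => simp [moveStrand]
  | cons y l ih =>
    unfold moveStrand
    split_ifs
    · exact List.Perm.refl _
    · exact ((ih (p + 1)).cons y).trans (List.Perm.swap _ _ _)

theorem sortStrands_perm (r ov : α → α → Prop) (p : ℕ) (l : List α) :
    (sortStrands r ov p l).1.Perm l := by
  induction l generalizing p with
  | nil => simp [sortStrands]
  | cons y l ih =>
    simp only [sortStrands]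
    exact (moveStrand_perm _ _ _ _ _).trans ((ih (p + 1)).cons y)

theorem moveStrand_pairwise (r ov : α → α → Prop) [IsStrictTotalOrder α r] (p : ℕ) (x : α)
    (l : List α) (hl : l.Pairwise r) (hx : x ∉ l) : (moveStrand r ov p x l).1.Pairwise r := by
  induction l generalizing p with
  | nil => simp [moveStrand]
  | cons y l ih =>
    rw [List.pairwise_cons] at hl
    unfold moveStrand
    split_ifs with h
    · refine List.pairwise_cons.2 ⟨fun z hz => ?_, List.pairwise_cons.2 hl⟩
      rcases List.mem_cons.1 hz with rfl | hz
      · exact h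
      · exact _root_.trans h (hl.1 z hz)
    · refine List.pairwise_cons.2 ⟨fun z hz => ?_, ih (p + 1) hl.2 (by simp_all)⟩
      rcases List.mem_cons.1 ((moveStrand_perm _ _ _ _ _).mem_iff.1 hz) with rfl | hz
      · rcases trichotomous_of r z y with h' | rfl | h'
        · exact absurd h' h
        · simp at hx
        · exact h'
      · exact hl.1 z hz

theorem sortStrands_pairwise (r ov : α → α → Prop) [IsStrictTotalOrder α r] (p : ℕ)
    (l : List α) (hl : l.Nodup) : (sortStrands r ov p l).1.Pairwise r := by
  induction l generalizing p with
  | nil => simp [sortStrands]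
  | cons y l ih =>
    rw [List.nodup_cons] at hl
    exact moveStrand_pairwise _ _ _ _ _ (ih (p + 1) hl.2)
      (by rw [(sortStrands_perm _ _ _ _).mem_iff]; exact hl.1)

theorem eq_of_perm_of_pairwise {r : α → α → Prop} [IsStrictTotalOrder α r] {l l' : List α}
    (h : l.Perm l') (hl : l.Pairwise r) (hl' : l'.Pairwise r) : l = l' :=
  h.eq_of_pairwise (fun _ _ _ _ h1 h2 => absurd h2 (asymm_of r h1)) hl hl'

theorem moveStrand_congr {r ov ov' : α → α → Prop} (p : ℕ) (x : α) (l : List α)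
    (h : ∀ y ∈ l, ¬ r x y → (ov x y ↔ ov' x y)) :
    moveStrand r ov p x l = moveStrand r ov' p x l := by
  induction l generalizing p with
  | nil => rfl
  | cons y l ih =>
    simp only [moveStrand]
    split_ifs with hr
    · rfl
    · rw [ih (p + 1) fun z hz => h z (List.mem_cons_of_mem _ hz)]
      rw [decide_eq_decide.2 (h y List.mem_cons_self hr)]

/-- Two strands cross in the sorting word only if the order of the list contradicts `r`, so `ov`
matters for such pairs alone. This allows actual heights to be replaced by a global order of layers.
-/
theorem sortStrands_congr {r ov ov' : α → α → Prop} (p : ℕ) (l : List α)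
    (h : l.Pairwise fun x y => ¬ r x y → (ov x y ↔ ov' x y)) :
    sortStrands r ov p l = sortStrands r ov' p l := by
  induction l generalizing p with
  | nil => rfl
  | cons y l ih =>
    rw [List.pairwise_cons] at h
    simp only [sortStrands]
    rw [ih (p + 1) h.2, moveStrand_congr]
    intro z hz
    exact h.1 z ((sortStrands_perm _ _ _ _).mem_iff.1 hz)

theorem moveStrand_map (e : α → β) (r ov : β → β → Prop) (p : ℕ) (x : α) (l : List α) :
    moveStrand r ov p (e x) (l.map e) =
      Prod.map (List.map e) id (moveStrand (fun a b => r (e a) (e b)) (fun a b => ov (e a) (e b))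
        p x l) := by
  induction l generalizing p with
  | nil => rfl
  | cons y l ih =>
    simp only [moveStrand, List.map_cons]
    split_ifs with hr
    · rfl
    · simp [ih]

theorem sortStrands_map (e : α → β) (r ov : β → β → Prop) (p : ℕ) (l : List α) :
    sortStrands r ov p (l.map e) =
      Prod.map (List.map e) id (sortStrands (fun a b => r (e a) (e b)) (fun a b => ov (e a) (e b))
        p l) := by
  induction l generalizing p with
  | nil => rfl
  | cons y l ih =>
    simp only [sortStrands, List.map_cons, ih, Prod.map_fst, Prod.map_snd, moveStrand_map, id]
    rfl

/-- The braid that brings the strands of a list into the order of the layers, where the strands of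
the upper layers pass over those of the lower layers and come first; `ov x y` says that `x` lies
in a layer above `y`. -/
noncomputable def layerBraid (n : ℕ) (ov : α → α → Prop) (p : ℕ) (l : List α) : BraidGroup n :=
  braidOfWord n (sortStrands ov ov p l).2

theorem commute_moveStrand (n : ℕ) (r ov : α → α → Prop) (p i : ℕ) (x : α) (l : List α)
    (h : i + 2 ≤ p) : Commute (braidGen n i) (braidOfWord n (moveStrand r ov p x l).2) := by
  induction l generalizing p with
  | nil => exact Commute.one_right _
  | cons y l ih =>
    simp only [moveStrand]
    split_ifs
    · exact Commute.one_right _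
    · rw [braidOfWord_cons]
      refine Commute.mul_right ?_ (ih (p + 1) (by omega))
      have : Commute (braidGen n i) (braidGen n p) := braidGen_comm (by omega)
      unfold braidLetter
      split_ifs
      · exact this
      · exact this.inv_right

theorem commute_sortStrands (n : ℕ) (r ov : α → α → Prop) (p i : ℕ) (l : List α)
    (h : i + 2 ≤ p) : Commute (braidGen n i) (braidOfWord n (sortStrands r ov p l).2) := by
  induction l generalizing p with
  | nil => exact Commute.one_right _
  | cons y l ih =>
    simp only [sortStrands, braidOfWord_append]
    exact (ih (p + 1) (by omega)).mul_right (commute_moveStrand _ _ _ _ _ _ _ h)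

/-- Bringing `x` and `y` to their places in either order gives braids that differ by one crossing.
Induction on the list: if `x` precedes the head `z`, it stops at once and only the crossing with `y`
remains; otherwise both strands pass under `z`, and the crossing moves past `z` by the braid
relation. -/
theorem moveStrand_moveStrand (n : ℕ) (r : α → α → Prop) [IsStrictTotalOrder α r] (p : ℕ) (x y : α)
    (hxy : r x y) (l : List α) (hn : p + l.length + 2 ≤ n) :
    braidOfWord n (moveStrand r r (p + 1) x l).2 *
        braidOfWord n (moveStrand r r p y (moveStrand r r (p + 1) x l).1).2 =
      (braidGen n p)⁻¹ * (braidOfWord n (moveStrand r r (p + 1) y l).2 *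
        braidOfWord n (moveStrand r r p x (moveStrand r r (p + 1) y l).1).2) := by
  have hyx : ¬ r y x := asymm_of r hxy
  induction l generalizing p with
  | nil => simp [moveStrand, hxy, hyx, braidLetter]
  | cons z l ih =>
    by_cases hxz : r x z
    · have h1 : (moveStrand r r (p + 1) x (z :: l)) = (x :: z :: l, []) := by
        simp [moveStrand, hxz]
      have h2 : (moveStrand r r p x (moveStrand r r (p + 1) y (z :: l)).1).2 = [] := by
        by_cases hyz : r y z <;> simp [moveStrand, hxz, hyz, hxy]
      rw [h1, h2]
      simp [moveStrand, hyx, braidLetter]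
    · have hyz : ¬ r y z := fun h => hxz (_root_.trans hxy h)
      have e1 : moveStrand r r (p + 1) x (z :: l) =
          (z :: (moveStrand r r (p + 2) x l).1,
            (p + 1, false) :: (moveStrand r r (p + 2) x l).2) := by
        simp [moveStrand, hxz]
      have e2 : moveStrand r r (p + 1) y (z :: l) =
          (z :: (moveStrand r r (p + 2) y l).1,
            (p + 1, false) :: (moveStrand r r (p + 2) y l).2) := by
        simp [moveStrand, hyz]
      have e3 : ∀ m : List α, (moveStrand r r p y (z :: m)).2 =
          (p, false) :: (moveStrand r r (p + 1) y m).2 := by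
        intro m; simp [moveStrand, hyz]
      have e4 : ∀ m : List α, (moveStrand r r p x (z :: m)).2 =
          (p, false) :: (moveStrand r r (p + 1) x m).2 := by
        intro m; simp [moveStrand, hxz]
      rw [e1, e2]
      simp only [e3, e4, braidOfWord_cons, braidLetter, Bool.false_eq_true, if_false]
      have hl : (z :: l).length = l.length + 1 := rfl
      have IH := ih (p + 1) (by omega)
      have c1 := (commute_moveStrand n r r (p + 2) p x l le_rfl).inv_left.eq
      have c2 := (commute_moveStrand n r r (p + 2) p y l le_rfl).inv_left.eq
      -- When a list is sorted by its own layer order, a strand moves right only under others, so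
      -- all letters are negative and the braid relation is needed for inverses.
      have hb := congrArg (·⁻¹) (braidGen_braid (n := n) (i := p) (by omega))
      simp only [mul_inv_rev] at hb
      generalize braidOfWord n (moveStrand r r (p + 2) x l).2 = X at *
      generalize braidOfWord n (moveStrand r r (p + 2) y l).2 = Y at *
      generalize braidOfWord n (moveStrand r r (p + 1) y _).2 = Y' at *
      generalize braidOfWord n (moveStrand r r (p + 1) x _).2 = X' at *
      generalize (braidGen n p)⁻¹ = a at *
      generalize (braidGen n (p + 1))⁻¹ = b at *
      calc b * X * (a * Y') = b * (X * a) * Y' := by group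
        _ = b * a * (X * Y') := by rw [← c1]; group
        _ = b * a * b * (Y * X') := by rw [IH]; group
        _ = a * b * (a * Y) * X' := by rw [← mul_assoc b a b] at hb; rw [← hb]; group
        _ = _ := by rw [c2]; group

theorem layerBraid_swap_head (n : ℕ) (r : α → α → Prop) [IsStrictTotalOrder α r] (p : ℕ) (x y : α)
    (hxy : r x y) (l : List α) (hn : p + l.length + 2 ≤ n) :
    layerBraid n r p (y :: x :: l) = (braidGen n p)⁻¹ * layerBraid n r p (x :: y :: l) := by
  unfold layerBraid
  simp only [sortStrands, braidOfWord_append, mul_assoc]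
  rw [moveStrand_moveStrand n r p x y hxy _
    (by rw [(sortStrands_perm _ _ _ _).length_eq]; exact hn), ← mul_assoc,
    ← (commute_sortStrands n r r (p + 1 + 1) p l le_rfl).inv_left.eq, mul_assoc]

/-- Exchanging two neighbouring strands multiplies the layered braid by their crossing. -/
theorem layerBraid_swap (n : ℕ) (r : α → α → Prop) [IsStrictTotalOrder α r] (p : ℕ)
    (l₁ : List α) (x y : α) (l : List α) (hd : (l₁ ++ x :: y :: l).Nodup)
    (hn : p + (l₁ ++ x :: y :: l).length ≤ n) [Decidable (r x y)] :
    layerBraid n r p (l₁ ++ x :: y :: l) =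
      braidLetter n (p + l₁.length) (decide (r x y)) * layerBraid n r p (l₁ ++ y :: x :: l) := by
  induction l₁ generalizing p with
  | nil =>
    simp only [List.nil_append, List.length_cons] at hn
    simp only [List.nil_append, List.length_nil, add_zero]
    by_cases h : r x y
    · rw [layerBraid_swap_head n r p x y h l (by omega)]
      simp [h, braidLetter]
    · have h' : r y x := by
        rcases trichotomous_of r x y with h' | h' | h'
        · exact absurd h' h
        · simp [h'] at hd
        · exact h'
      rw [layerBraid_swap_head n r p y x h' l (by omega)]
      simp [h, braidLetter]
  | cons z l₁ ih =>
    simp only [List.cons_append, List.nodup_cons, List.length_cons] at hd hn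
    have IH := ih (p + 1) hd.2 (by omega)
    have hp : (l₁ ++ x :: y :: l).Perm (l₁ ++ y :: x :: l) :=
      (List.Perm.swap _ _ _).append_left _
    have hs : (sortStrands r r (p + 1) (l₁ ++ x :: y :: l)).1 =
        (sortStrands r r (p + 1) (l₁ ++ y :: x :: l)).1 :=
      eq_of_perm_of_pairwise (r := r)
        (((sortStrands_perm _ _ _ _).trans hp).trans (sortStrands_perm _ _ _ _).symm)
        (sortStrands_pairwise _ _ _ _ hd.2) (sortStrands_pairwise _ _ _ _ (hp.nodup_iff.1 hd.2))
    unfold layerBraid at IH ⊢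
    simp only [List.cons_append, sortStrands, braidOfWord_append, List.length_cons, hs, IH]
    rw [mul_assoc, show p + 1 + l₁.length = p + (l₁.length + 1) by omega]

/-- `layerBraid_swap` telescopes along the way of `x`. The target order `r` is unrelated to the
layers `ov`. -/
theorem layerBraid_moveStrand (n : ℕ) (ov : α → α → Prop) [IsStrictTotalOrder α ov]
    (r : α → α → Prop) (l₁ : List α) (x : α) (l : List α) (hd : (l₁ ++ x :: l).Nodup)
    (hn : (l₁ ++ x :: l).length ≤ n) :
    layerBraid n ov 0 (l₁ ++ x :: l) = braidOfWord n (moveStrand r ov l₁.length x l).2 *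
      layerBraid n ov 0 (l₁ ++ (moveStrand r ov l₁.length x l).1) := by
  classical
  induction l generalizing l₁ with
  | nil => simp [moveStrand]
  | cons y l ih =>
    simp only [moveStrand]
    split_ifs with h
    · simp
    · have hp : (l₁ ++ x :: y :: l).Perm ((l₁ ++ [y]) ++ x :: l) := by
        simpa using (List.Perm.swap y x l).append_left l₁
      have IH := ih (l₁ ++ [y]) (hp.nodup_iff.1 hd) (by rw [← hp.length_eq]; exact hn)
      rw [layerBraid_swap n ov 0 l₁ x y l hd (by omega)]
      simp only [List.append_assoc, List.singleton_append, List.length_append, List.length_singleton]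
        at IH
      rw [IH, braidOfWord_cons, zero_add, mul_assoc]

/-- The word that brings a list of strands into the order `r` spells the quotient of the layered
braids of the two lists. -/
theorem layerBraid_sortStrands (n : ℕ) (ov : α → α → Prop) [IsStrictTotalOrder α ov]
    (r : α → α → Prop) (l₁ l : List α) (hd : (l₁ ++ l).Nodup) (hn : (l₁ ++ l).length ≤ n) :
    layerBraid n ov 0 (l₁ ++ l) = braidOfWord n (sortStrands r ov l₁.length l).2 *
      layerBraid n ov 0 (l₁ ++ (sortStrands r ov l₁.length l).1) := by
  induction l generalizing l₁ with
  | nil => simp [sortStrands]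
  | cons x l ih =>
    have IH := ih (l₁ ++ [x]) (by simpa using hd) (by simpa using hn)
    simp only [List.append_assoc, List.singleton_append, List.length_append, List.length_singleton]
      at IH
    have hp : (l₁ ++ x :: (sortStrands r ov (l₁.length + 1) l).1).Perm (l₁ ++ x :: l) :=
      ((sortStrands_perm _ _ _ _).cons _).append_left _
    simp only [sortStrands, braidOfWord_append]
    rw [IH, layerBraid_moveStrand n ov r l₁ x _ (hp.nodup_iff.2 hd) (by rwa [hp.length_eq]),
      mul_assoc]

theorem layerBraid_map (n : ℕ) (e : α → β) (ov : β → β → Prop) (p : ℕ) (l : List α) :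
    layerBraid n ov p (l.map e) = layerBraid n (fun a b => ov (e a) (e b)) p l := by
  simp [layerBraid, sortStrands_map]

theorem moveStrand_of_forall {r ov : α → α → Prop} {p : ℕ} {x : α} {l : List α}
    (h : ∀ y ∈ l, r x y) : moveStrand r ov p x l = (x :: l, []) := by
  cases l with
  | nil => rfl
  | cons y l => simp [moveStrand, h y List.mem_cons_self]

theorem sortStrands_of_pairwise {r ov : α → α → Prop} {p : ℕ} {l : List α} (h : l.Pairwise r) :
    sortStrands r ov p l = (l, []) := by
  induction l generalizing p with
  | nil => rfl
  | cons y l ih =>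
    rw [List.pairwise_cons] at h
    simp [sortStrands, ih h.2, moveStrand_of_forall h.1]

theorem layerBraid_of_pairwise {n : ℕ} {ov : α → α → Prop} {p : ℕ} {l : List α}
    (h : l.Pairwise ov) : layerBraid n ov p l = 1 := by
  simp [layerBraid, sortStrands_of_pairwise h]

end Sorting

/-! ### The half twist -/

theorem List.map_swap_of_nodup {α : Type*} [DecidableEq α] {l₁ l₂ : List α} {x y : α}
    (h : (l₁ ++ x :: y :: l₂).Nodup) :
    (l₁ ++ x :: y :: l₂).map (Equiv.swap x y) = l₁ ++ y :: x :: l₂ := by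
  have key : ∀ l : List α, x ∉ l → y ∉ l → l.map (Equiv.swap x y) = l := by
    intro l hx hy
    conv_rhs => rw [← List.map_id l]
    refine List.map_congr_left fun z hz => ?_
    rw [Equiv.swap_apply_of_ne_of_ne]
    · rfl
    · rintro rfl; exact hx hz
    · rintro rfl; exact hy hz
  have h' := List.nodup_append.1 h
  have hx := List.nodup_cons.1 h'.2.1
  have hy := List.nodup_cons.1 hx.2
  rw [List.map_append, List.map_cons, List.map_cons, Equiv.swap_apply_left,
    Equiv.swap_apply_right, key l₁, key l₂]
  · exact fun hm => hx.1 (List.mem_cons_of_mem _ hm)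
  · exact hy.1
  · exact fun hm => h'.2.2 x hm x (by simp) rfl
  · exact fun hm => h'.2.2 y hm y (by simp) rfl

theorem List.exists_append_finRange {n i : ℕ} (h : i + 1 < n) :
    ∃ l₁ l₂ : List (Fin n), l₁.length = i ∧ l₂.length = n - 2 - i ∧
      List.finRange n = l₁ ++ ⟨i, Nat.lt_of_succ_lt h⟩ :: ⟨i + 1, h⟩ :: l₂ := by
  refine ⟨(List.finRange n).take i, (List.finRange n).drop (i + 2), by simp; omega,
    by simp; omega, ?_⟩
  conv_lhs => rw [← List.take_append_drop i (List.finRange n)]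
  rw [List.drop_eq_getElem_cons (by simp; omega), List.drop_eq_getElem_cons (by simp; omega)]
  simp

/-- The braid that brings the strands `0, 1, …, n - 1` into the reverse order, where the strands of
the greater numbers pass over those of the smaller numbers. -/
noncomputable def halfTwist (n : ℕ) : BraidGroup n :=
  layerBraid n (fun a b : Fin n => b < a) 0 (List.finRange n)

instance isStrictTotalOrder_flip_lt (n : ℕ) :
    IsStrictTotalOrder (Fin n) fun a b => b < a :=
  inferInstanceAs (IsStrictTotalOrder (Fin n) (· > ·))

theorem pairwise_gt_reverse_finRange (n : ℕ) :
    (List.finRange n).reverse.Pairwise fun a b => b < a :=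
  List.pairwise_reverse.2 (List.pairwise_lt_finRange n)

theorem layerBraid_lt_finRange (n : ℕ) :
    layerBraid n (fun a b : Fin n => a < b) 0 (List.finRange n) = 1 :=
  layerBraid_of_pairwise (List.pairwise_lt_finRange n)

theorem layerBraid_gt_reverse_finRange (n : ℕ) :
    layerBraid n (fun a b : Fin n => b < a) 0 (List.finRange n).reverse = 1 :=
  layerBraid_of_pairwise (pairwise_gt_reverse_finRange n)

theorem layerBraid_lt_reverse_finRange (n : ℕ) :
    layerBraid n (fun a b : Fin n => a < b) 0 (List.finRange n).reverse = halfTwist n := by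
  rw [List.finRange_reverse, layerBraid_map]
  simp only [Fin.rev_lt_rev]
  rfl

variable {n i : ℕ}

theorem layerBraid_finRange_swap (h : i + 1 < n) (ov : Fin n → Fin n → Prop)
    [IsStrictTotalOrder (Fin n) ov] [Decidable (ov ⟨i, Nat.lt_of_succ_lt h⟩ ⟨i + 1, h⟩)] :
    layerBraid n ov 0 (List.finRange n) =
      braidLetter n i (decide (ov ⟨i, Nat.lt_of_succ_lt h⟩ ⟨i + 1, h⟩)) *
        layerBraid n ov 0 ((List.finRange n).map (Equiv.swap ⟨i, Nat.lt_of_succ_lt h⟩ ⟨i + 1, h⟩)) := by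
  obtain ⟨l₁, l₂, h1, -, h3⟩ := List.exists_append_finRange h
  have hd := List.nodup_finRange n
  have hl : (List.finRange n).length = n := List.length_finRange
  rw [h3] at hd hl ⊢
  rw [List.map_swap_of_nodup hd, layerBraid_swap n ov 0 l₁ _ _ l₂ hd (by rw [zero_add, hl]),
    zero_add, h1]

theorem layerBraid_reverse_finRange_swap (h : i + 1 < n) (ov : Fin n → Fin n → Prop)
    [IsStrictTotalOrder (Fin n) ov] [Decidable (ov ⟨i + 1, h⟩ ⟨i, Nat.lt_of_succ_lt h⟩)] :
    layerBraid n ov 0 (List.finRange n).reverse =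
      braidLetter n (n - 2 - i) (decide (ov ⟨i + 1, h⟩ ⟨i, Nat.lt_of_succ_lt h⟩)) *
        layerBraid n ov 0
          ((List.finRange n).reverse.map (Equiv.swap ⟨i, Nat.lt_of_succ_lt h⟩ ⟨i + 1, h⟩)) := by
  obtain ⟨l₁, l₂, -, h2, h3⟩ := List.exists_append_finRange h
  have hd := List.nodup_reverse.2 (List.nodup_finRange n)
  have hl : (List.finRange n).reverse.length = n := by simp
  rw [h3] at hd hl ⊢
  simp only [List.reverse_append, List.reverse_cons, List.append_assoc,
    List.cons_append, List.nil_append] at hd hl ⊢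
  rw [Equiv.swap_comm, List.map_swap_of_nodup hd,
    layerBraid_swap n ov 0 l₂.reverse _ _ l₁.reverse hd (by rw [zero_add, hl]), zero_add,
    List.length_reverse, h2]

/-- Conjugation by the half twist mirrors the strands. The proof relabels the strands by a
transposition `s`: a swap at the start of the half twist is a letter at `i`, a swap at its end one
at the mirrored place. -/
theorem braidGen_mul_halfTwist (h : i + 1 < n) :
    braidGen n i * halfTwist n = halfTwist n * braidGen n (n - 2 - i) := by
  have h1 := layerBraid_finRange_swap h (fun a b => b < a)
  have h2 := layerBraid_reverse_finRange_swap h (fun a b => b < a)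
  rw [layerBraid_gt_reverse_finRange] at h2
  simp only [Fin.mk_lt_mk, lt_add_iff_pos_right, zero_lt_one, decide_true] at h2
  rw [show decide ((⟨i + 1, h⟩ : Fin n) < ⟨i, Nat.lt_of_succ_lt h⟩) = false by simp] at h1
  set s := Equiv.swap (⟨i, Nat.lt_of_succ_lt h⟩ : Fin n) ⟨i + 1, h⟩ with hs
  -- The sorting of `0, …, n - 1` into the order of the relabelled reversed list is read in two
  -- ways: as the permutation braid of the layers relabelled by `s`, and as a quotient of
  -- permutation braids of the original layers.
  have h3 : layerBraid n (fun a b : Fin n => b < a) 0 ((List.finRange n).map s) =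
      halfTwist n * (layerBraid n (fun a b : Fin n => b < a) 0
        ((List.finRange n).reverse.map s))⁻¹ := by
    have htot : IsStrictTotalOrder (Fin n) fun a b => s b < s a :=
      (RelIso.preimage s (fun a b : Fin n => b < a)).toRelEmbedding.isStrictTotalOrder
    have hlen : (List.finRange n).length = n := List.length_finRange
    rw [layerBraid_map, eq_mul_inv_iff_mul_eq]
    unfold layerBraid
    -- In both orders of layers the strand that starts on the left passes under at each crossing
    -- that occurs, so the words agree.
    rw [sortStrands_congr (ov' := fun a b => b < a)]
    · have h4 := layerBraid_sortStrands n (fun a b : Fin n => b < a) (fun a b => s b < s a) []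
        (List.finRange n) (List.nodup_finRange n) hlen.le
      have h5 : (sortStrands (fun a b : Fin n => s b < s a) (fun a b => b < a) 0
          (List.finRange n)).1 = (List.finRange n).reverse.map s := by
        refine eq_of_perm_of_pairwise (r := fun a b : Fin n => s b < s a) ?_
          (sortStrands_pairwise _ _ _ _ (List.nodup_finRange n)) ?_
        · refine (sortStrands_perm _ _ _ _).trans ((List.perm_ext_iff_of_nodup
            (List.nodup_finRange n) ?_).2 fun a => ?_)
          · exact (List.nodup_reverse.2 (List.nodup_finRange n)).map s.injective
          · simp only [List.mem_finRange, List.mem_map, List.mem_reverse, true_and, true_iff]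
            exact ⟨s a, by simp [hs]⟩
        · rw [List.pairwise_map]
          simpa [hs] using pairwise_gt_reverse_finRange n
      simp only [List.nil_append, List.length_nil, h5] at h4
      exact h4.symm
    · refine (List.pairwise_lt_finRange n).imp fun {a b} hab hn => ?_
      exact iff_of_false hn (not_lt_of_gt hab)
  rw [h3] at h1
  simp only [braidLetter, if_true, Bool.false_eq_true, if_false] at h1 h2
  rw [eq_comm, mul_eq_one_iff_inv_eq] at h2
  rw [← h2, inv_inv, eq_inv_mul_iff_mul_eq] at h1
  exact h1

/-! ### The braid between two times -/

theorem orderedList_spec {α : Type*} [Finite α] (r : α → α → Prop) [IsStrictTotalOrder α r] :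
    (orderedList r).Nodup ∧ (∀ a, a ∈ orderedList r) ∧ (orderedList r).Pairwise r := by
  classical
  have h : ∃ l : List α, l.Nodup ∧ (∀ a, a ∈ l) ∧ l.Pairwise r := by
    have := Fintype.ofFinite α
    have hp := sortStrands_perm r r 0 (Finset.univ : Finset α).toList
    exact ⟨(sortStrands r r 0 (Finset.univ : Finset α).toList).1,
      hp.nodup_iff.2 (Finset.nodup_toList _), fun a => hp.mem_iff.2 (by simp),
      sortStrands_pairwise _ _ _ _ (Finset.nodup_toList _)⟩
  rw [orderedList, dif_pos h]
  exact h.choose_spec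

theorem orderedList_eq {α : Type*} [Finite α] {r : α → α → Prop} [IsStrictTotalOrder α r]
    {l : List α} (hd : l.Nodup) (hm : ∀ a, a ∈ l) (hl : l.Pairwise r) : orderedList r = l := by
  obtain ⟨h1, h2, h3⟩ := orderedList_spec r
  exact eq_of_perm_of_pairwise ((List.perm_ext_iff_of_nodup h1 hd).2 fun a => by simp [h2, hm]) h3 hl

namespace JugglingPattern

variable {P : JugglingPattern} {c d u v : ℝ}

variable (P) in
/-- Two balls have the same position at time `t`. -/
def Meet (c d t : ℝ) : Prop := ∃ a b : P.Ball, a ≠ b ∧ position c d a t = position c d b t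

/-- By the intermediate value theorem two continuous strands cannot change sides without meeting. -/
theorem lt_or_gt_of_forall_not_meet (hc : ∀ b : P.Ball, Continuous (position c d b))
    (h : ∀ t ∈ Set.Ioo u v, ¬ P.Meet c d t) {a b : P.Ball} (hab : a ≠ b) :
    (∀ s ∈ Set.Ioo u v, position c d a s < position c d b s) ∨
      ∀ s ∈ Set.Ioo u v, position c d b s < position c d a s := by
  by_contra! hcon
  obtain ⟨⟨s, hs, h1⟩, s', hs', h2⟩ := hcon
  obtain ⟨t, ht, heq⟩ := isPreconnected_Ioo.intermediate_value₂ hs' hs (hc a).continuousOn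
    (hc b).continuousOn h2 h1
  exact h t ht ⟨a, b, hab, heq⟩

theorem ltAfter_of_forall (huv : u < v) {a b : P.Ball}
    (h : ∀ s ∈ Set.Ioo u v, position c d a s < position c d b s) : LtAfter c d u a b := by
  filter_upwards [Ioo_mem_nhdsGT huv] with s hs using h s hs

theorem ltBefore_of_forall (huv : u < v) {a b : P.Ball}
    (h : ∀ s ∈ Set.Ioo u v, position c d a s < position c d b s) : LtBefore c d v a b := by
  filter_upwards [Ioo_mem_nhdsLT huv] with s hs using h s hs

theorem LtAfter.asymm {t : ℝ} {a b : P.Ball} (h : LtAfter c d t a b) : ¬ LtAfter c d t b a :=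
  fun h' => by
    obtain ⟨s, h1, h2⟩ := (Filter.Eventually.and h h').exists
    exact lt_asymm h1 h2

theorem LtBefore.asymm {t : ℝ} {a b : P.Ball} (h : LtBefore c d t a b) : ¬ LtBefore c d t b a :=
  fun h' => by
    obtain ⟨s, h1, h2⟩ := (Filter.Eventually.and h h').exists
    exact lt_asymm h1 h2

theorem isStrictTotalOrder_ltAfter (hc : ∀ b : P.Ball, Continuous (position c d b)) (huv : u < v)
    (h : ∀ t ∈ Set.Ioo u v, ¬ P.Meet c d t) :
    IsStrictTotalOrder P.Ball (LtAfter (P := P) c d u) where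
  irrefl a ha := ha.asymm ha
  trans a b e h1 h2 := by
    filter_upwards [h1, h2] with s h1 h2 using h1.trans h2
  trichotomous a b h1 h2 := by
    by_contra hab
    rcases lt_or_gt_of_forall_not_meet hc h hab with h' | h'
    · exact h1 (ltAfter_of_forall huv h')
    · exact h2 (ltAfter_of_forall huv h')

theorem isStrictTotalOrder_ltBefore (hc : ∀ b : P.Ball, Continuous (position c d b)) (huv : u < v)
    (h : ∀ t ∈ Set.Ioo u v, ¬ P.Meet c d t) :
    IsStrictTotalOrder P.Ball (LtBefore (P := P) c d v) where
  irrefl a ha := ha.asymm ha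
  trans a b e h1 h2 := by
    filter_upwards [h1, h2] with s h1 h2 using h1.trans h2
  trichotomous a b h1 h2 := by
    by_contra hab
    rcases lt_or_gt_of_forall_not_meet hc h hab with h' | h'
    · exact h1 (ltBefore_of_forall huv h')
    · exact h2 (ltBefore_of_forall huv h')

theorem ltAfter_eq_ltBefore (hc : ∀ b : P.Ball, Continuous (position c d b)) (huv : u < v)
    (h : ∀ t ∈ Set.Ioo u v, ¬ P.Meet c d t) :
    LtAfter (P := P) c d u = LtBefore (P := P) c d v := by
  ext a b
  by_cases hab : a = b
  · subst hab
    exact iff_of_false (fun h => h.asymm h) fun h => h.asymm h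
  rcases lt_or_gt_of_forall_not_meet hc h hab with h' | h'
  · exact iff_of_true (ltAfter_of_forall huv h') (ltBefore_of_forall huv h')
  · exact iff_of_false (ltAfter_of_forall huv h').asymm (ltBefore_of_forall huv h').asymm

theorem ltAfter_of_lt (hc : ∀ b : P.Ball, Continuous (position c d b)) {a b : P.Ball}
    (h : position c d a u < position c d b u) : LtAfter c d u a b :=
  ((hc a).continuousAt.eventually_lt (hc b).continuousAt h).filter_mono nhdsWithin_le_nhds

theorem ltBefore_of_lt (hc : ∀ b : P.Ball, Continuous (position c d b)) {a b : P.Ball}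
    (h : position c d a u < position c d b u) : LtBefore c d u a b :=
  ((hc a).continuousAt.eventually_lt (hc b).continuousAt h).filter_mono nhdsWithin_le_nhds

/-- Many balls may meet at the same time, even at several places. By continuity only balls at equal
positions can change their order, and for these the heights agree with `L`, so the word is one of
layered crossings. -/
theorem braidOfWord_crossingsAt [Finite P.Ball] (hc : ∀ b : P.Ball, Continuous (position c d b))
    {t : ℝ} (hu : u < t) (hv : t < v) (h₁ : ∀ s ∈ Set.Ioo u t, ¬ P.Meet c d s)
    (h₂ : ∀ s ∈ Set.Ioo t v, ¬ P.Meet c d s) (L : P.Ball → P.Ball → Prop)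
    [IsStrictTotalOrder P.Ball L]
    (hL : ∀ a b : P.Ball, a ≠ b → position c d a t = position c d b t → (IsAbove d t a b ↔ L a b)) :
    braidOfWord (Nat.card P.Ball) (P.crossingsAt c d t) =
      layerBraid (Nat.card P.Ball) L 0 (orderedList (LtBefore (P := P) c d t)) *
        (layerBraid (Nat.card P.Ball) L 0 (orderedList (LtAfter (P := P) c d t)))⁻¹ := by
  have i1 := isStrictTotalOrder_ltBefore hc hu h₁
  have i2 := isStrictTotalOrder_ltAfter hc hv h₂
  obtain ⟨b1, b2, b3⟩ := orderedList_spec (LtBefore (P := P) c d t)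
  rw [eq_mul_inv_iff_mul_eq, crossingsAt, sortStrands_congr (ov' := L)]
  · have := layerBraid_sortStrands (Nat.card P.Ball) L (LtAfter (P := P) c d t) []
      (orderedList (LtBefore (P := P) c d t)) b1 (by
        have := Fintype.ofFinite P.Ball
        rw [Nat.card_eq_fintype_card]
        exact b1.length_le_card)
    rw [List.nil_append, List.nil_append, List.length_nil] at this
    rw [this]
    congr 3
    refine orderedList_eq ((sortStrands_perm _ _ _ _).nodup_iff.2 b1)
      (fun a => (sortStrands_perm _ _ _ _).mem_iff.2 (b2 a)) (sortStrands_pairwise _ _ _ _ b1)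
  · refine b3.imp fun {a b} hab hn => ?_
    have hne : a ≠ b := by
      rintro rfl
      exact hab.asymm hab
    refine hL a b hne ?_
    by_contra hpos
    rcases lt_or_gt_of_ne hpos with h | h
    · exact hn (ltAfter_of_lt hc h)
    · exact hab.asymm (ltBefore_of_lt hc h)

/-- The quotients at the single crossing times telescope, since the order just after a crossing time
is that just before the next one. -/
theorem braidOfWord_flatMap_crossingsAt [Finite P.Ball]
    (hc : ∀ b : P.Ball, Continuous (position c d b)) (L : P.Ball → P.Ball → Prop)
    [IsStrictTotalOrder P.Ball L] (ts : List ℝ) (huv : u < v) (hs : ts.Pairwise (· < ·))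
    (hts : ∀ t, t ∈ ts ↔ t ∈ Set.Ioo u v ∧ P.Meet c d t)
    (hL : ∀ t ∈ Set.Ioo u v, ∀ a b : P.Ball, a ≠ b → position c d a t = position c d b t →
      (IsAbove d t a b ↔ L a b)) :
    braidOfWord (Nat.card P.Ball) (ts.flatMap (P.crossingsAt c d)) =
      layerBraid (Nat.card P.Ball) L 0 (orderedList (LtAfter (P := P) c d u)) *
        (layerBraid (Nat.card P.Ball) L 0 (orderedList (LtBefore (P := P) c d v)))⁻¹ := by
  induction ts generalizing u with
  | nil =>
    have hfree : ∀ t ∈ Set.Ioo u v, ¬ P.Meet c d t := fun t ht hm => by simpa using (hts t).2 ⟨ht, hm⟩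
    rw [ltAfter_eq_ltBefore hc huv hfree]
    simp
  | cons t ts ih =>
    rw [List.pairwise_cons] at hs
    obtain ⟨⟨hut, htv⟩, hmt⟩ := (hts t).1 List.mem_cons_self
    have hfree₁ : ∀ s ∈ Set.Ioo u t, ¬ P.Meet c d s := fun s hsm hm => by
      rcases List.mem_cons.1 ((hts s).2 ⟨⟨hsm.1, hsm.2.trans htv⟩, hm⟩) with h | h
      · exact hsm.2.ne h
      · exact (hs.1 s h).not_gt hsm.2
    obtain ⟨v', htv', hfree₂⟩ : ∃ v', t < v' ∧ ∀ s ∈ Set.Ioo t v', ¬ P.Meet c d s := by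
      cases ts with
      | nil =>
        refine ⟨v, htv, fun s hsm hm => ?_⟩
        have := (hts s).2 ⟨⟨hut.trans hsm.1, hsm.2⟩, hm⟩
        rw [List.mem_singleton] at this
        exact hsm.1.ne' this
      | cons t' ts =>
        refine ⟨t', hs.1 t' List.mem_cons_self, fun s hsm hm => ?_⟩
        have ht' := ((hts t').1 (by simp)).1.2
        rcases List.mem_cons.1 ((hts s).2 ⟨⟨hut.trans hsm.1, hsm.2.trans ht'⟩, hm⟩) with h | h
        · exact hsm.1.ne' h
        · rcases List.mem_cons.1 h with h | h
          · exact hsm.2.ne h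
          · exact ((List.pairwise_cons.1 hs.2).1 s h).not_gt hsm.2
    have IH := ih htv hs.2 (fun s => ⟨fun h => ?_, fun h => ?_⟩)
      fun s hsm => hL s ⟨hut.trans hsm.1, hsm.2⟩
    · rw [List.flatMap_cons, braidOfWord_append, IH, braidOfWord_crossingsAt hc hut htv' hfree₁
        hfree₂ L (hL t ⟨hut, htv⟩), ltAfter_eq_ltBefore hc hut hfree₁]
      group
    · have := (hts s).1 (List.mem_cons_of_mem _ h)
      exact ⟨⟨hs.1 s h, this.1.2⟩, this.2⟩
    · rcases List.mem_cons.1 ((hts s).2 ⟨⟨hut.trans h.1.1, h.1.2⟩, h.2⟩) with h' | h'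
      · exact absurd h' h.1.1.ne'
      · exact h'

variable (P) in
/-- The braid of the crossings at a finite set of times. -/
noncomputable def braidAtTimes (c d : ℝ) (S : Finset ℝ) : BraidGroup (Nat.card P.Ball) :=
  braidOfWord (Nat.card P.Ball) ((S.sort (· ≤ ·)).flatMap (P.crossingsAt c d))

theorem braidAtTimes_union {S T U : Finset ℝ} (hU : ∀ t, t ∈ U ↔ t ∈ S ∨ t ∈ T)
    (h : ∀ s ∈ S, ∀ t ∈ T, s < t) :
    P.braidAtTimes c d U = P.braidAtTimes c d S * P.braidAtTimes c d T := by
  have : U.sort (· ≤ ·) = S.sort (· ≤ ·) ++ T.sort (· ≤ ·) := by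
    refine List.Perm.eq_of_pairwise (fun a b _ _ => le_antisymm) (Finset.pairwise_sort _ _)
      (List.pairwise_append.2 ⟨Finset.pairwise_sort _ _, Finset.pairwise_sort _ _, ?_⟩)
      ((List.perm_ext_iff_of_nodup (Finset.sort_nodup _ _) ?_).2 ?_)
    · intro s hs t ht
      exact (h s (by simpa using hs) t (by simpa using ht)).le
    · refine List.nodup_append.2 ⟨Finset.sort_nodup _ _, Finset.sort_nodup _ _, ?_⟩
      intro s hs t ht
      exact (h s (by simpa using hs) t (by simpa using ht)).ne
    · intro t
      simp [hU]
  rw [braidAtTimes, this, List.flatMap_append, braidOfWord_append, braidAtTimes, braidAtTimes]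

/-- The braid between two times, if in between the heights of meeting balls are ordered in
layers. -/
theorem braidAtTimes_eq_of_layers [Finite P.Ball]
    (hc : ∀ b : P.Ball, Continuous (position c d b)) (L : P.Ball → P.Ball → Prop)
    [IsStrictTotalOrder P.Ball L] (S : Finset ℝ) (huv : u < v)
    (hS : ∀ t, t ∈ S ↔ t ∈ Set.Ioo u v ∧ P.Meet c d t)
    (hL : ∀ t ∈ Set.Ioo u v, ∀ a b : P.Ball, a ≠ b → position c d a t = position c d b t →
      (IsAbove d t a b ↔ L a b))
    {l l' : List P.Ball} (hd : l.Nodup) (hm : ∀ b, b ∈ l)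
    (hl : l.Pairwise fun a b => position c d a u < position c d b u)
    (hd' : l'.Nodup) (hm' : ∀ b, b ∈ l')
    (hl' : l'.Pairwise fun a b => position c d a v < position c d b v) :
    P.braidAtTimes c d S =
      layerBraid (Nat.card P.Ball) L 0 l * (layerBraid (Nat.card P.Ball) L 0 l')⁻¹ := by
  have key : ∀ {w : ℝ} {m : List P.Ball}, (∀ b, b ∈ m) →
      m.Pairwise (fun a b => position c d a w < position c d b w) →
      IsStrictTotalOrder P.Ball (fun a b => position c d a w < position c d b w) := by
    intro w m hm hp
    refine { irrefl := fun a => lt_irrefl _, trans := fun a b e => lt_trans,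
             trichotomous := fun a b h1 h2 => ?_ }
    by_contra hab
    have : Std.Symm fun a b : P.Ball => position c d a w ≠ position c d b w := ⟨fun _ _ => Ne.symm⟩
    exact (hp.imp (S := fun a b => position c d a w ≠ position c d b w) fun h => h.ne).forall
      (hm a) (hm b) hab (le_antisymm (not_lt.1 h2) (not_lt.1 h1))
  have i1 := key hm hl
  have i2 := key hm' hl'
  have e1 : orderedList (LtAfter (P := P) c d u) = l := by
    have : LtAfter (P := P) c d u = fun a b => position c d a u < position c d b u := by
      ext a b
      refine ⟨fun h => ?_, ltAfter_of_lt hc⟩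
      rcases trichotomous_of (fun a b => position c d a u < position c d b u) a b with h' | h' | h'
      · exact h'
      · exact absurd (h' ▸ h) fun h => h.asymm h
      · exact absurd (ltAfter_of_lt hc h') h.asymm
    rw [this]
    exact orderedList_eq hd hm hl
  have e2 : orderedList (LtBefore (P := P) c d v) = l' := by
    have : LtBefore (P := P) c d v = fun a b => position c d a v < position c d b v := by
      ext a b
      refine ⟨fun h => ?_, ltBefore_of_lt hc⟩
      rcases trichotomous_of (fun a b => position c d a v < position c d b v) a b with h' | h' | h'
      · exact h'
      · exact absurd (h' ▸ h) fun h => h.asymm h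
      · exact absurd (ltBefore_of_lt hc h') h.asymm
    rw [this]
    exact orderedList_eq hd' hm' hl'
  rw [braidAtTimes, braidOfWord_flatMap_crossingsAt hc L _ huv (Finset.sortedLT_sort S).pairwise
    (fun t => by rw [Finset.mem_sort, hS]) hL, e1, e2]

end JugglingPattern

/-! ### Patterns in rounds -/

/-- The data of a juggling pattern in which `n` balls are thrown round by round from one hand to
the other. In round `r` the balls are thrown at the beats `time r + 2 * k` for `k < n`, and `perm r`
is the permutation of the balls from the order of their throws in round `r` to that of their
catches, that is, of their throws in round `r + 1`. -/
structure Schedule (n : ℕ) where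
  /-- the first beat of a round -/
  time : ℤ → ℤ
  /-- the time between the first beats of a round and the next one -/
  flight : ℤ → ℤ
  /-- the change of the order of the balls in a round -/
  perm : ℤ → Equiv.Perm (Fin n)
  /-- an upper bound for the flight times -/
  bound : ℤ
  /-- the number of rounds in a period -/
  rounds : ℕ
  /-- the length of a period -/
  length : ℕ
  time_succ : ∀ r, time (r + 1) = time r + flight r
  even_time : ∀ r, Even (time r) ↔ Even r
  le_flight : ∀ r, 16 * (n : ℤ) + 8 ≤ flight r
  flight_le : ∀ r, flight r ≤ bound
  gap : ∀ r, 6 ≤ |flight (r + 1) - flight r|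
  perm_near : ∀ r k, |((perm r k : ℕ) : ℤ) - (k : ℕ)| ≤ 1
  length_pos : 0 < length
  time_periodic : ∀ r, time (r + rounds) = time r + length
  perm_periodic : ∀ r, perm (r + rounds) = perm r

namespace Schedule

variable {n : ℕ} (S : Schedule n)

/-- Different rounds occupy disjoint blocks of beats, which makes `beat` injective. -/
theorem time_add_le {r s : ℤ} (h : r < s) : S.time r + (16 * (n : ℤ) + 8) ≤ S.time s := by
  have h' : r + 1 ≤ s := h
  induction s, h' using Int.leInduction with
  | base => rw [S.time_succ]; have := S.le_flight r; omega
  | succ s hs ih =>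
    rw [S.time_succ]
    have := S.le_flight s
    have := ih (by omega)
    omega

/-- The beat of a slot of a round. -/
def beat (x : ℤ × Fin n) : ℤ := S.time x.1 + 2 * (x.2 : ℕ)

theorem beat_injective : Function.Injective S.beat := by
  rintro ⟨r, k⟩ ⟨s, l⟩ h
  simp only [beat] at h
  have hk := k.2
  have hl := l.2
  rcases lt_trichotomy r s with hrs | rfl | hrs
  · have := S.time_add_le hrs; omega
  · rw [Prod.mk.injEq]
    exact ⟨rfl, Fin.ext (by omega)⟩
  · have := S.time_add_le hrs; omega

/-- The map from each slot to the slot of the next throw of the same ball. -/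
def next : Equiv.Perm (ℤ × Fin n) where
  toFun x := (x.1 + 1, S.perm x.1 x.2)
  invFun x := (x.1 - 1, (S.perm (x.1 - 1)).symm x.2)
  left_inv x := by simp
  right_inv x := by simp

/-- Each step raises the round by one, so an orbit has exactly one slot in each round; hence the
balls correspond to the `n` slots of any round. -/
theorem next_zpow_fst (i : ℤ) (x : ℤ × Fin n) : ((S.next ^ i) x).1 = x.1 + i := by
  induction i using Int.induction_on with
  | zero => simp
  | succ i ih => rw [add_comm, zpow_add, zpow_one, Equiv.Perm.mul_apply]; simp only [next,
      Equiv.coe_fn_mk] at ih ⊢; omega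
  | pred i ih =>
    rw [sub_eq_add_neg, add_comm, zpow_add, zpow_neg_one, Equiv.Perm.mul_apply]
    change (((S.next ^ (-(i : ℤ))) x).1) - 1 = _
    omega

/-- The slots as a set of beats. -/
def beatEmbedding : ℤ × Fin n ↪ ℤ := ⟨S.beat, S.beat_injective⟩

/-- The bijection of the beats. -/
noncomputable def throwPerm : Equiv.Perm ℤ := S.next.viaEmbedding S.beatEmbedding

theorem throwPerm_beat (x : ℤ × Fin n) : S.throwPerm (S.beat x) = S.beat (S.next x) :=
  Equiv.Perm.viaEmbedding_apply _ S.beatEmbedding x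

theorem throwPerm_of_notMem {t : ℤ} (h : t ∉ Set.range S.beat) : S.throwPerm t = t :=
  Equiv.Perm.viaEmbedding_apply_of_notMem _ S.beatEmbedding t h

theorem throwPerm_zpow_beat (i : ℤ) (x : ℤ × Fin n) :
    (S.throwPerm ^ i) (S.beat x) = S.beat ((S.next ^ i) x) := by
  change ((Equiv.Perm.viaEmbeddingHom S.beatEmbedding S.next) ^ i) (S.beatEmbedding x) = _
  rw [← map_zpow]
  exact Equiv.Perm.viaEmbedding_apply _ S.beatEmbedding x

theorem beat_lt_beat_next (x : ℤ × Fin n) : S.beat x < S.beat (S.next x) := by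
  have h1 := S.time_add_le (lt_add_one x.1)
  have h2 := x.2.2
  simp only [beat, next, Equiv.coe_fn_mk]
  omega

theorem beat_add_length (r : ℤ) (k : Fin n) :
    S.beat (r, k) + S.length = S.beat (r + S.rounds, k) := by
  simp only [beat, S.time_periodic]
  ring

theorem throwPerm_add_length (t : ℤ) : S.throwPerm (t + S.length) = S.throwPerm t + S.length := by
  by_cases h : t ∈ Set.range S.beat
  · obtain ⟨⟨r, k⟩, rfl⟩ := h
    rw [beat_add_length, throwPerm_beat, throwPerm_beat]
    simp only [next, Equiv.coe_fn_mk, S.perm_periodic]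
    rw [beat_add_length, add_right_comm]
  · rw [S.throwPerm_of_notMem h, S.throwPerm_of_notMem]
    rintro ⟨⟨r, k⟩, hr⟩
    apply h
    refine ⟨(r - S.rounds, k), ?_⟩
    have := S.beat_add_length (r - S.rounds) k
    rw [sub_add_cancel, hr] at this
    omega

/-- The juggling pattern of a schedule. -/
noncomputable def pattern : JugglingPattern where
  f := S.throwPerm
  le_apply t := by
    by_cases h : t ∈ Set.range S.beat
    · obtain ⟨x, rfl⟩ := h
      rw [throwPerm_beat]
      exact (S.beat_lt_beat_next x).le
    · rw [S.throwPerm_of_notMem h]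
  periodic := ⟨S.length, S.length_pos, fun t => by rw [throwPerm_add_length]; ring⟩

theorem pattern_f_beat (x : ℤ × Fin n) : S.pattern.f (S.beat x) = S.beat (S.next x) :=
  S.throwPerm_beat x

/-! ### The balls of a schedule and their slots -/

variable {S}

theorem exists_ball_eq (b : S.pattern.Ball) :
    ∃ x, b.1 = Set.range fun i : ℤ => S.beat ((S.next ^ i) x) := by
  obtain ⟨t, ht, hb⟩ := b.2
  have hr : t ∈ Set.range S.beat := by
    by_contra h
    exact ht (S.throwPerm_of_notMem h)
  obtain ⟨x, rfl⟩ := hr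
  refine ⟨x, ?_⟩
  rw [hb]
  ext u
  simp only [Set.mem_ofPred_eq, Set.mem_range, ← throwPerm_zpow_beat]
  rfl

theorem exists_slot (b : S.pattern.Ball) (r : ℤ) : ∃ k, S.beat (r, k) ∈ b.1 := by
  obtain ⟨x, hx⟩ := exists_ball_eq b
  refine ⟨((S.next ^ (r - x.1)) x).2, ?_⟩
  rw [hx]
  refine ⟨r - x.1, congrArg S.beat (Prod.ext ?_ rfl)⟩
  simp [next_zpow_fst]

/-- The slot of a ball in a round. -/
noncomputable def slot (r : ℤ) (b : S.pattern.Ball) : Fin n := (exists_slot b r).choose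

theorem beat_slot_mem (r : ℤ) (b : S.pattern.Ball) : S.beat (r, slot r b) ∈ b.1 :=
  (exists_slot b r).choose_spec

theorem slot_eq {r : ℤ} {b : S.pattern.Ball} {k : Fin n} (h : S.beat (r, k) ∈ b.1) :
    slot r b = k := by
  have h' := beat_slot_mem r b
  obtain ⟨x, hx⟩ := exists_ball_eq b
  rw [hx] at h h'
  obtain ⟨i, hi⟩ := h
  obtain ⟨j, hj⟩ := h'
  have hi := S.beat_injective hi
  have hj := S.beat_injective hj
  have h1 := congrArg Prod.fst hi
  have h2 := congrArg Prod.fst hj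
  rw [next_zpow_fst] at h1 h2
  simp only at h1 h2
  obtain rfl : i = j := by omega
  rw [hi] at hj
  exact (congrArg Prod.snd hj).symm

theorem throwPerm_mem {b : S.pattern.Ball} {t : ℤ} (h : t ∈ b.1) : S.throwPerm t ∈ b.1 := by
  obtain ⟨x, hx⟩ := exists_ball_eq b
  rw [hx] at h ⊢
  obtain ⟨i, rfl⟩ := h
  refine ⟨1 + i, ?_⟩
  simp only [throwPerm_beat, zpow_add, zpow_one, Equiv.Perm.mul_apply]

theorem slot_succ (r : ℤ) (b : S.pattern.Ball) : slot (r + 1) b = S.perm r (slot r b) := by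
  apply slot_eq
  have := throwPerm_mem (beat_slot_mem r b)
  rw [throwPerm_beat] at this
  exact this

/-- The beat of a ball in a round. -/
noncomputable def ballBeat (b : S.pattern.Ball) (r : ℤ) : ℤ := S.beat (r, slot r b)

theorem f_ballBeat (b : S.pattern.Ball) (r : ℤ) :
    S.pattern.f (ballBeat b r) = ballBeat b (r + 1) := by
  rw [ballBeat, pattern_f_beat, ballBeat, slot_succ]
  rfl

theorem mem_ball_iff {b : S.pattern.Ball} {t : ℤ} : t ∈ b.1 ↔ ∃ r, ballBeat b r = t := by
  constructor
  · intro h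
    obtain ⟨x, hx⟩ := exists_ball_eq b
    have h' := h
    rw [hx] at h'
    obtain ⟨i, rfl⟩ := h'
    refine ⟨((S.next ^ i) x).1, ?_⟩
    rw [ballBeat, slot_eq (r := ((S.next ^ i) x).1) (k := ((S.next ^ i) x).2) h]
  · rintro ⟨r, rfl⟩
    exact beat_slot_mem r b

theorem ballBeat_strictMono (b : S.pattern.Ball) : StrictMono (ballBeat b) := by
  intro r s h
  have h1 := S.time_add_le h
  have h2 := (slot r b).2
  have h3 := (slot s b).2
  simp only [ballBeat, beat]
  omega

theorem slot_injective (r : ℤ) : Function.Injective (slot (S := S) r) := by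
  intro a b h
  have ha := beat_slot_mem r a
  have hb := beat_slot_mem r b
  rw [h] at ha
  obtain ⟨t, -, hta⟩ := a.2
  obtain ⟨u, -, hub⟩ := b.2
  apply Subtype.ext
  rw [hta] at ha ⊢
  rw [hub] at hb ⊢
  ext v
  exact ⟨fun h => hb.trans (ha.symm.trans h), fun h => ha.trans (hb.symm.trans h)⟩

theorem slot_surjective (r : ℤ) : Function.Surjective (slot (S := S) r) := by
  intro k
  refine ⟨⟨{u | S.pattern.f.SameCycle (S.beat (r, k)) u}, S.beat (r, k), ?_, rfl⟩, slot_eq ?_⟩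
  · rw [pattern_f_beat]
    exact (S.beat_lt_beat_next _).ne'
  · exact Equiv.Perm.SameCycle.refl _ _

/-- The balls, numbered by their slots in a round. -/
noncomputable def ballEquiv (S : Schedule n) (r : ℤ) : Fin n ≃ S.pattern.Ball :=
  (Equiv.ofBijective (slot r) ⟨slot_injective r, slot_surjective r⟩).symm

@[simp] theorem slot_ballEquiv (r : ℤ) (k : Fin n) : slot r (S.ballEquiv r k) = k :=
  (Equiv.ofBijective (slot r) ⟨slot_injective r, slot_surjective r⟩).apply_symm_apply k

@[simp] theorem ballEquiv_slot (r : ℤ) (b : S.pattern.Ball) : S.ballEquiv r (slot r b) = b :=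
  (Equiv.ofBijective (slot r) ⟨slot_injective r, slot_surjective r⟩).symm_apply_apply b

instance : Finite S.pattern.Ball := Finite.of_equiv _ (S.ballEquiv 0)

variable (S) in
theorem card_ball : Nat.card S.pattern.Ball = n := by
  rw [← Nat.card_congr (S.ballEquiv 0), Nat.card_fin]

/-! ### Positions and heights -/

open JugglingPattern

/-- The distance of a position from the wall of the round `r`. -/
noncomputable def fromWall (r : ℤ) (x : ℝ) : ℝ := if Even r then x else 1 - x

theorem fromWall_succ (r : ℤ) (x : ℝ) : fromWall (r + 1) x = 1 - fromWall r x := by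
  unfold fromWall
  by_cases h : Even r
  · rw [if_pos h, if_neg (by simpa [Int.even_add_one] using h)]
  · rw [if_neg h, if_pos (by simpa [Int.even_add_one] using h)]
    ring

theorem even_ballBeat (b : S.pattern.Ball) (r : ℤ) : Even (ballBeat b r) ↔ Even r := by
  rw [ballBeat, beat, Int.even_add, S.even_time]
  simp

theorem exists_round (b : S.pattern.Ball) (s : ℝ) :
    ∃ r, (ballBeat b r : ℝ) ≤ s ∧ s < ballBeat b (r + 1) := by
  have hm := ballBeat_strictMono b
  have hlow : ∃ r, ballBeat b r ≤ ⌊s⌋ := by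
    refine ⟨-(ballBeat b 0 - ⌊s⌋).natAbs, ?_⟩
    have : ∀ m : ℕ, ballBeat b (-(m : ℤ)) ≤ ballBeat b 0 - m := by
      intro m
      induction m with
      | zero => simp
      | succ m ih =>
        have : ballBeat b (-((m + 1 : ℕ) : ℤ)) < ballBeat b (-(m : ℤ)) := hm (by omega)
        omega
    have := this (ballBeat b 0 - ⌊s⌋).natAbs
    omega
  have hhigh : ∃ B : ℤ, ∀ r, ballBeat b r ≤ ⌊s⌋ → r ≤ B := by
    refine ⟨(⌊s⌋ - ballBeat b 0).natAbs, fun r hr => ?_⟩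
    by_contra hcon
    have : ∀ m : ℕ, ballBeat b 0 + m ≤ ballBeat b (m : ℤ) := by
      intro m
      induction m with
      | zero => simp
      | succ m ih =>
        have : ballBeat b (m : ℤ) < ballBeat b ((m + 1 : ℕ) : ℤ) := hm (by omega)
        omega
    have h1 := this (⌊s⌋ - ballBeat b 0).natAbs
    have h2 := hm (not_le.1 hcon)
    omega
  obtain ⟨B, hB⟩ := hhigh
  obtain ⟨r, hr, hmax⟩ := Int.exists_greatest_of_bdd ⟨B, hB⟩ hlow
  refine ⟨r, Int.le_floor.1 hr, Int.floor_lt.1 ?_⟩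
  by_contra hcon
  have := hmax _ (not_lt.1 hcon)
  omega

variable {c d : ℝ}

theorem lastBeat_eq {b : S.pattern.Ball} {r : ℤ} {s : ℝ} (h : (ballBeat b r : ℝ) - d / 2 ≤ s)
    (h' : s < ballBeat b (r + 1) - d / 2) : lastBeat d b s = ballBeat b r := by
  refine IsGreatest.csSup_eq ⟨⟨mem_ball_iff.2 ⟨r, rfl⟩, h⟩, ?_⟩
  rintro t ⟨ht, hts⟩
  obtain ⟨q, rfl⟩ := mem_ball_iff.1 ht
  apply (ballBeat_strictMono b).monotone
  by_contra hcon
  have : ballBeat b (r + 1) ≤ ballBeat b q := (ballBeat_strictMono b).monotone (by omega)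
  have : (ballBeat b (r + 1) : ℝ) ≤ ballBeat b q := by exact_mod_cast this
  linarith

theorem ballBeat_add_le (b : S.pattern.Ball) (r : ℤ) :
    (ballBeat b r : ℝ) + 8 ≤ ballBeat b (r + 1) := by
  have h1 := S.time_add_le (lt_add_one r)
  have h2 := (slot r b).2
  have h : ballBeat b r + 8 ≤ ballBeat b (r + 1) := by
    simp only [ballBeat, beat]
    omega
  exact_mod_cast h

theorem fromWall_outside (b : S.pattern.Ball) (r : ℤ) : fromWall r (outside (ballBeat b r)) = 0 := by
  unfold fromWall outside
  simp only [even_ballBeat]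
  split_ifs <;> ring

theorem fromWall_inside (b : S.pattern.Ball) (r : ℤ) :
    fromWall r (inside c (ballBeat b r)) = c := by
  unfold fromWall inside
  simp only [even_ballBeat]
  split_ifs <;> ring

theorem fromWall_lineMap (r : ℤ) (x y w : ℝ) :
    fromWall r (AffineMap.lineMap x y w) = (1 - w) * fromWall r x + w * fromWall r y := by
  unfold fromWall
  rw [AffineMap.lineMap_apply_module]
  split_ifs <;> simp only [smul_eq_mul] <;> ring

theorem fromWall_position_carry (hd : 0 < d) (hd1 : d < 1) {b : S.pattern.Ball} {r : ℤ} {s : ℝ}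
    (h : (ballBeat b r : ℝ) - d / 2 ≤ s) (h' : s ≤ ballBeat b r + d / 2) :
    fromWall r (position c d b s) = c * ((s - (ballBeat b r - d / 2)) / d) := by
  have h8 := ballBeat_add_le b r
  have hl : lastBeat d b s = ballBeat b r := lastBeat_eq h (by linarith)
  simp only [position, hl]
  rw [if_pos h', fromWall_lineMap, fromWall_outside, fromWall_inside]
  ring

theorem fromWall_position_flight (hd : 0 < d) (hd1 : d < 1) {b : S.pattern.Ball} {r : ℤ} {s : ℝ}
    (h : (ballBeat b r : ℝ) + d / 2 ≤ s) (h' : s ≤ ballBeat b (r + 1) - d / 2) :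
    fromWall (r + 1) (position c d b s) =
      (1 - c) * ((ballBeat b (r + 1) - d / 2 - s) / (ballBeat b (r + 1) - ballBeat b r - d)) := by
  have h8 := ballBeat_add_le b r
  -- The definition of `position` uses the carry branch at both ends of the flight: at the catch
  -- `lastBeat` has already jumped, and at the throw the carry includes its endpoint. The formulas
  -- agree there.
  rcases h'.eq_or_lt with rfl | h'
  · rw [fromWall_position_carry hd hd1 le_rfl (by linarith)]
    simp
  rcases h.eq_or_lt with rfl | h
  · have h9 : (ballBeat b (r + 1) : ℝ) - ballBeat b r - d ≠ 0 := by linarith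
    rw [fromWall_succ, fromWall_position_carry hd hd1 (by linarith) le_rfl]
    field_simp
    ring
  · have hl : lastBeat d b s = ballBeat b r := lastBeat_eq (by linarith) h'
    simp only [position, hl]
    rw [if_neg (not_le.2 h), f_ballBeat, fromWall_lineMap, fromWall_outside, fromWall_succ,
      fromWall_inside]
    have h9 : (ballBeat b (r + 1) : ℝ) - ballBeat b r - d ≠ 0 := by linarith
    rw [show (ballBeat b (r + 1) : ℝ) - d / 2 - (ballBeat b r + d / 2) =
      ballBeat b (r + 1) - ballBeat b r - d by ring]
    field_simp
    ring

theorem height_flight (hd : 0 < d) (hd1 : d < 1) {b : S.pattern.Ball} {r : ℤ} {s : ℝ}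
    (h : (ballBeat b r : ℝ) + d / 2 ≤ s) (h' : s ≤ ballBeat b (r + 1) - d / 2) :
    height d b s = (s - (ballBeat b r + d / 2)) * (ballBeat b (r + 1) - d / 2 - s) := by
  have h8 := ballBeat_add_le b r
  -- At the catch `lastBeat` is already the next beat; both formulas give height 0.
  rcases h'.eq_or_lt with rfl | h'
  · have hl : lastBeat d b (ballBeat b (r + 1) - d / 2) = ballBeat b (r + 1) :=
      lastBeat_eq le_rfl (by linarith [ballBeat_add_le b (r + 1)])
    simp only [height, hl]
    rw [if_pos (by linarith)]
    ring
  have hl : lastBeat d b s = ballBeat b r := lastBeat_eq (by linarith) h'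
  simp only [height, hl, f_ballBeat]
  split_ifs with h''
  · rw [le_antisymm h'' h]
    ring
  · rfl

theorem continuousOn_of_fromWall {r : ℤ} {g : ℝ → ℝ} {A : Set ℝ}
    (h : ContinuousOn (fun s => fromWall r (g s)) A) : ContinuousOn g A := by
  unfold fromWall at h
  split_ifs at h
  · exact h
  · refine (continuousOn_const (c := (1 : ℝ)).sub h).congr fun s _ => ?_
    simp

theorem continuous_position (hd : 0 < d) (hd1 : d < 1) (b : S.pattern.Ball) :
    Continuous (position c d b) := by
  have hcarry : ∀ r, ContinuousOn (position c d b)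
      (Set.Icc (ballBeat b r - d / 2) (ballBeat b r + d / 2)) := by
    intro r
    apply continuousOn_of_fromWall (r := r)
    refine ContinuousOn.congr (f := fun s => c * ((s - (ballBeat b r - d / 2)) / d)) (by fun_prop)
      fun s hs => fromWall_position_carry hd hd1 hs.1 hs.2
  have hflight : ∀ r, ContinuousOn (position c d b)
      (Set.Icc (ballBeat b r + d / 2) (ballBeat b (r + 1) - d / 2)) := by
    intro r
    apply continuousOn_of_fromWall (r := r + 1)
    refine ContinuousOn.congr (f := fun s => (1 - c) * ((ballBeat b (r + 1) - d / 2 - s) /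
      (ballBeat b (r + 1) - ballBeat b r - d))) (by fun_prop)
      fun s hs => fromWall_position_flight hd hd1 hs.1 hs.2
  rw [continuous_iff_continuousAt]
  intro s
  have right : ∀ x y : ℝ, ContinuousOn (position c d b) (Set.Icc x y) → x ≤ s → s < y →
      ContinuousWithinAt (position c d b) (Set.Ici s) s := by
    intro x y h hx hy
    refine (h s ⟨hx, hy.le⟩).mono_of_mem_nhdsWithin ?_
    filter_upwards [self_mem_nhdsWithin, mem_nhdsWithin_of_mem_nhds (Iio_mem_nhds hy)] with z h1 h2
      using ⟨hx.trans h1, le_of_lt h2⟩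
  have left : ∀ x y : ℝ, ContinuousOn (position c d b) (Set.Icc x y) → x < s → s ≤ y →
      ContinuousWithinAt (position c d b) (Set.Iic s) s := by
    intro x y h hx hy
    refine (h s ⟨hx.le, hy⟩).mono_of_mem_nhdsWithin ?_
    filter_upwards [self_mem_nhdsWithin, mem_nhdsWithin_of_mem_nhds (Ioi_mem_nhds hx)] with z h1 h2
      using ⟨le_of_lt h2, le_trans h1 hy⟩
  obtain ⟨r, h1, h2⟩ := exists_round b s
  rw [continuousAt_iff_continuous_left_right]
  constructor
  · rcases le_or_gt s (ballBeat b r + d / 2) with h | h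
    · exact left _ _ (hcarry r) (by linarith) h
    · rcases le_or_gt s (ballBeat b (r + 1) - d / 2) with h' | h'
      · exact left _ _ (hflight r) h h'
      · exact left _ _ (hcarry (r + 1)) h' (by linarith)
  · rcases lt_or_ge s (ballBeat b r + d / 2) with h | h
    · exact right _ _ (hcarry r) (by linarith) h
    · rcases lt_or_ge s (ballBeat b (r + 1) - d / 2) with h' | h'
      · exact right _ _ (hflight r) h h'
      · exact right _ _ (hcarry (r + 1)) h' (by linarith)

end Schedule

/-! ### Flights that meet -/

/-- `A * l' ≤ A * l + 4 * A < (A + 2) * l`. It is applied to balls of one round, whose beats are at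
least 2 apart and whose flight times differ by at most 4: the order of elapsed or remaining times is
also the order of fractions as long as less than half of the flight is concerned. -/
theorem div_lt_div_of_near {A A' l l' : ℝ} (h : A + 2 ≤ A') (h0 : 0 ≤ A) (hl : 2 * A < l)
    (hl' : 0 < l') (hll : l' ≤ l + 4) : A / l < A' / l' := by
  rw [div_lt_div_iff₀ (by linarith) hl']
  have h1 : A * l' ≤ A * (l + 4) := mul_le_mul_of_nonneg_left hll h0
  have h2 : (A + 2) * l ≤ A' * l := mul_le_mul_of_nonneg_right h (by linarith)
  linarith

/-- At equal fractions, a longer elapsed time means a proportionally longer flight, and heights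
scale with the square of its length. -/
theorem height_lt_of_same_direction {p q lp lq : ℝ} (hq : 0 < q) (hqp : q < p) (hp : p < lp)
    (h : p / lp = q / lq) (hlq : 0 < lq) : q * (lq - q) < p * (lp - p) := by
  have hp0 : 0 < p := hq.trans hqp
  rw [div_eq_div_iff (by linarith) hlq.ne'] at h
  have h1 : p * (q * (lq - q)) = q ^ 2 * (lp - p) := by linear_combination q * h
  have h2 : q ^ 2 * (lp - p) < p ^ 2 * (lp - p) :=
    mul_lt_mul_of_pos_right (by nlinarith) (by linarith)
  have h3 : p * (q * (lq - q)) < p * (p * (lp - p)) := by rw [h1]; linarith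
  exact lt_of_mul_lt_mul_left h3 hp0.le

/-- The smaller fraction `f` costs the longer flight at most `k * l ^ 2` in height, while its length
gains at least `2 * f * l`. The last hypothesis keeps `f` away from 0, so that the gain wins. -/
theorem height_lt_of_longer {f k l l' m : ℝ} (hf : 0 < f) (hf' : f ≤ 1 / 2) (hk : 0 < k)
    (hkm : k * (4 * m ^ 2) ≤ 1) (hl : 8 ≤ l) (hll : l + 2 ≤ l') (hl' : l' ≤ m)
    (h : 1 ≤ f * l' + (f + k) * l) :
    (f + k) * (1 - (f + k)) * l ^ 2 < f * (1 - f) * l' ^ 2 := by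
  have hm : 0 < m := by linarith
  have hkl : k * l ≤ k * m := mul_le_mul_of_nonneg_left (by linarith) hk.le
  have hkm1 : k * m * (4 * m) ≤ 1 := by linarith
  have hkm2 : k * m ≤ 1 / 2 := by
    have h0 : k * m * 32 ≤ k * m * (4 * m) :=
      mul_le_mul_of_nonneg_left (by linarith) (mul_pos hk hm).le
    linarith
  have h1 : 1 / 2 ≤ f * (l + l') := by linarith
  have h2 : f * (l + l') ≤ f * (2 * m) := mul_le_mul_of_nonneg_left (by linarith) hf.le
  have h3 : 1 ≤ 4 * (f * m) := by linarith
  have h4 : f / 2 ≤ f * (1 - f) := by linarith [mul_nonneg hf.le (sub_nonneg.2 hf')]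
  have h5 : 4 * l < l' ^ 2 - l ^ 2 := by
    linarith [pow_le_pow_left₀ (by linarith) hll 2]
  have h6 : k * l < 2 * f := by
    have : k * m * (4 * m) < 2 * f * (4 * m) := by linarith
    linarith [lt_of_mul_lt_mul_right this (by linarith)]
  have h6' : k * l * l < 2 * f * l := mul_lt_mul_of_pos_right h6 (by linarith)
  have h7 : f / 2 * (4 * l) ≤ f * (1 - f) * (l' ^ 2 - l ^ 2) :=
    mul_le_mul h4 h5.le (by linarith) (mul_nonneg hf.le (by linarith))
  have h8 : (f + k) * (1 - (f + k)) ≤ f * (1 - f) + k := by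
    linarith [mul_pos hf hk, sq_nonneg k]
  have h9 : (f + k) * (1 - (f + k)) * l ^ 2 ≤ (f * (1 - f) + k) * l ^ 2 :=
    mul_le_mul_of_nonneg_right h8 (by positivity)
  linarith

theorem height_lt_of_shorter {f g l l' : ℝ} (hf : 0 < f) (hfg : f < g) (hg : g ≤ 1 / 2)
    (hl : 0 < l) (hll : l < l') : f * (1 - f) * l ^ 2 < g * (1 - g) * l' ^ 2 := by
  have h1 : f * (1 - f) < g * (1 - g) := by
    linarith [mul_pos (sub_pos.2 hfg) (by linarith : 0 < 1 - g - f)]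
  have h2 : l ^ 2 < l' ^ 2 := pow_lt_pow_left₀ hll hl.le two_ne_zero
  exact mul_lt_mul h1 h2.le (by positivity) (mul_nonneg (by linarith) (by linarith))

/-- Here `p` is the time since the throw of the outgoing ball and `q` the time left to the incoming
one. The outgoing ball started at distance `c` from the wall, so its fraction is smaller by `c / (1
- c)`. If the incoming flight is longer, both effects favour it; if the outgoing one is longer, `c`
must be small. -/
theorem height_lt_of_opposite_direction {c p q l l' m : ℝ} (hc : 0 < c) (hc' : c < 1 / 2)
    (hcm : c * (8 * m ^ 2) ≤ 1) (hp : 0 < p) (hpq : 1 ≤ p + q) (hl : 8 ≤ l)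
    (hl' : 8 ≤ l') (hpl : 2 * p ≤ l) (hql : 2 * q ≤ l') (hlm : l ≤ m)
    (h : c + (1 - c) * (p / l) = (1 - c) * (q / l')) :
    (l' + 2 ≤ l → q * (l' - q) < p * (l - p)) ∧ (l + 2 ≤ l' → p * (l - p) < q * (l' - q)) := by
  have hl0 : 0 < l := by linarith
  have hl0' : 0 < l' := by linarith
  obtain ⟨f, hf⟩ : ∃ f, f = p / l := ⟨_, rfl⟩
  obtain ⟨g, hg⟩ : ∃ g, g = q / l' := ⟨_, rfl⟩
  have hfp : p = f * l := by rw [hf, div_mul_cancel₀ _ hl0.ne']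
  have hgq : q = g * l' := by rw [hg, div_mul_cancel₀ _ hl0'.ne']
  rw [← hf, ← hg] at h
  have hf0 : 0 < f := hf ▸ div_pos hp hl0
  have hf1 : f ≤ 1 / 2 := by
    rw [hf, div_le_iff₀ hl0]
    linarith
  have hg1 : g ≤ 1 / 2 := by
    rw [hg, div_le_iff₀ hl0']
    linarith
  have hc1 : 0 < 1 - c := by linarith
  have hgf : g = f + c / (1 - c) := by
    field_simp
    linarith
  have hk : 0 < c / (1 - c) := div_pos hc hc1
  have e1 : p * (l - p) = f * (1 - f) * l ^ 2 := by rw [hfp]; ring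
  have e2 : q * (l' - q) = g * (1 - g) * l' ^ 2 := by rw [hgq]; ring
  rw [e1, e2]
  refine ⟨fun hll => ?_, fun hll => height_lt_of_shorter hf0 (by linarith) hg1 hl0 (by linarith)⟩
  rw [hfp, hgq] at hpq
  rw [hgf] at hpq ⊢
  refine height_lt_of_longer hf0 hf1 hk ?_ hl' hll hlm hpq
  have h2 : c / (1 - c) ≤ 2 * c := by
    rw [div_le_iff₀ hc1]
    linarith [mul_pos hc (by linarith : 0 < 1 / 2 - c)]
  linarith [mul_le_mul_of_nonneg_right h2 (by positivity : (0 : ℝ) ≤ 4 * m ^ 2)]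

/-! ### Estimates for small carry and dwell values -/

namespace Schedule

open JugglingPattern

variable {n : ℕ} {S : Schedule n} {c d : ℝ}

variable (S) in
/-- Carry and dwell values that are small enough for a schedule. -/
structure IsSmall (c d : ℝ) : Prop where
  c_pos : 0 < c
  d_pos : 0 < d
  d_le : d ≤ 1 / 2
  c_le : c * (8 * ((S.bound : ℝ) + 4) ^ 2) ≤ 1

theorem eight_le_bound : (8 : ℝ) ≤ S.bound := by
  have h1 := S.le_flight 0
  have h2 := S.flight_le 0
  have : (8 : ℤ) ≤ S.bound := by omega
  exact_mod_cast this

theorem IsSmall.d_lt_one (h : S.IsSmall c d) : d < 1 := by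
  have := h.d_le
  linarith

theorem IsSmall.c_lt (h : S.IsSmall c d) : c * ((S.bound : ℝ) + 4) < 1 / 8 := by
  have h1 := h.c_le
  have h2 := h.c_pos
  have h3 := eight_le_bound (S := S)
  have h4 : 0 < c * ((S.bound : ℝ) + 4) := by positivity
  nlinarith

theorem IsSmall.c_lt_half (h : S.IsSmall c d) : c < 1 / 2 := by
  have h1 := h.c_lt
  have h2 := h.c_pos
  have h3 := eight_le_bound (S := S)
  nlinarith

theorem le_flightTime (b : S.pattern.Ball) (r : ℤ) :
    (S.flight r : ℝ) - 2 ≤ ballBeat b (r + 1) - ballBeat b r := by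
  have h : S.flight r - 2 ≤ ballBeat b (r + 1) - ballBeat b r := by
    have := abs_le.1 (S.perm_near r (slot r b))
    simp only [ballBeat, beat, slot_succ, S.time_succ]
    omega
  exact_mod_cast h

theorem flightTime_le (b : S.pattern.Ball) (r : ℤ) :
    (ballBeat b (r + 1) : ℝ) - ballBeat b r ≤ S.flight r + 2 := by
  have h : ballBeat b (r + 1) - ballBeat b r ≤ S.flight r + 2 := by
    have := abs_le.1 (S.perm_near r (slot r b))
    simp only [ballBeat, beat, slot_succ, S.time_succ]
    omega
  exact_mod_cast h

theorem le_flight_real (r : ℤ) : 16 * (n : ℝ) + 8 ≤ S.flight r := by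
  exact_mod_cast S.le_flight r

theorem flight_le_real (r : ℤ) : (S.flight r : ℝ) ≤ S.bound := by
  exact_mod_cast S.flight_le r

theorem time_le_ballBeat (b : S.pattern.Ball) (r : ℤ) : (S.time r : ℝ) ≤ ballBeat b r := by
  have h : S.time r ≤ ballBeat b r := by
    simp only [ballBeat, beat]
    omega
  exact_mod_cast h

theorem ballBeat_le (b : S.pattern.Ball) (r : ℤ) :
    (ballBeat b r : ℝ) ≤ S.time r + 2 * n - 2 := by
  have h : ballBeat b r ≤ S.time r + 2 * n - 2 := by
    have := (slot r b).2
    simp only [ballBeat, beat]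
    omega
  exact_mod_cast h

theorem ballBeat_add_two_le {a b : S.pattern.Ball} {r : ℤ} (h : slot r a < slot r b) :
    (ballBeat a r : ℝ) + 2 ≤ ballBeat b r := by
  have h : ballBeat a r + 2 ≤ ballBeat b r := by
    have : (slot r a : ℕ) < slot r b := h
    simp only [ballBeat, beat]
    omega
  exact_mod_cast h

theorem fromWall_position_launch (hs : S.IsSmall c d) {b : S.pattern.Ball} {r : ℤ} {s : ℝ}
    (h : (ballBeat b r : ℝ) + d / 2 ≤ s) (h' : s ≤ ballBeat b (r + 1) - d / 2) :
    fromWall r (position c d b s) =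
      c + (1 - c) * ((s - (ballBeat b r + d / 2)) / (ballBeat b (r + 1) - ballBeat b r - d)) := by
  have h1 := fromWall_position_flight (c := c) hs.d_pos hs.d_lt_one h h'
  have h8 := ballBeat_add_le b r
  have hd := hs.d_lt_one
  have h9 : (ballBeat b (r + 1) : ℝ) - ballBeat b r - d ≠ 0 := by linarith
  rw [fromWall_succ, sub_eq_iff_eq_add, ← sub_eq_iff_eq_add'] at h1
  rw [← h1]
  field_simp
  ring

/-! #### The flights of a round -/

theorem fraction_eq_of_meet_mid (hs : S.IsSmall c d) {a b : S.pattern.Ball} {r : ℤ} {s : ℝ}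
    (h₁ : (S.time r : ℝ) + 2 * n - 1 ≤ s) (h₂ : s ≤ S.time (r + 1) - 1)
    (h : position c d a s = position c d b s) :
    (s - (ballBeat a r + d / 2)) / (ballBeat a (r + 1) - ballBeat a r - d) =
      (s - (ballBeat b r + d / 2)) / (ballBeat b (r + 1) - ballBeat b r - d) := by
  have hd := hs.d_le
  have ha := fromWall_position_launch hs (b := a) (r := r) (s := s)
    (by linarith [ballBeat_le a r]) (by linarith [time_le_ballBeat a (r + 1)])
  have hb := fromWall_position_launch hs (b := b) (r := r) (s := s)
    (by linarith [ballBeat_le b r]) (by linarith [time_le_ballBeat b (r + 1)])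
  rw [h, hb] at ha
  have hc := hs.c_lt_half
  exact (mul_left_cancel₀ (by linarith) (add_left_cancel ha)).symm

theorem height_lt_of_meet_mid (hs : S.IsSmall c d) {a b : S.pattern.Ball} {r : ℤ} {s : ℝ}
    (h₁ : (S.time r : ℝ) + 2 * n - 1 ≤ s) (h₂ : s ≤ S.time (r + 1) - 1)
    (h : position c d a s = position c d b s) (hab : slot r a < slot r b) :
    height d b s < height d a s := by
  have hd := hs.d_le
  have hd0 := hs.d_pos
  have heq := fraction_eq_of_meet_mid hs h₁ h₂ h
  have e1 := ballBeat_le a r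
  have e2 := ballBeat_le b r
  have e3 := time_le_ballBeat a (r + 1)
  have e4 := time_le_ballBeat b (r + 1)
  have e5 := ballBeat_add_two_le hab
  have e6 := ballBeat_add_le b r
  rw [height_flight hd0 hs.d_lt_one (r := r) (by linarith) (by linarith),
    height_flight hd0 hs.d_lt_one (r := r) (by linarith) (by linarith)]
  have := height_lt_of_same_direction (by linarith) (by linarith) (by linarith) heq (by linarith)
  convert this using 2 <;> ring

/-- In this window positions are linear in time. Two meetings would force equal flight times, and
then equal fractions would force equal beats of the throws. -/
theorem unique_meet_mid (hs : S.IsSmall c d) {a b : S.pattern.Ball} {r : ℤ} {s t : ℝ}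
    (hs₁ : (S.time r : ℝ) + 2 * n - 1 ≤ s) (hs₂ : s ≤ S.time (r + 1) - 1)
    (ht₁ : (S.time r : ℝ) + 2 * n - 1 ≤ t) (ht₂ : t ≤ S.time (r + 1) - 1)
    (h : position c d a s = position c d b s) (h' : position c d a t = position c d b t)
    (hab : slot r a < slot r b) : s = t := by
  have e1 := fraction_eq_of_meet_mid hs hs₁ hs₂ h
  have e2 := fraction_eq_of_meet_mid hs ht₁ ht₂ h'
  have hd := hs.d_lt_one
  have e3 := ballBeat_add_le a r
  have e4 := ballBeat_add_le b r
  have e5 := ballBeat_add_two_le hab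
  rw [div_eq_div_iff (by linarith) (by linarith)] at e1 e2
  have e6 : (s - t) * ((ballBeat b (r + 1) - ballBeat b r) -
      (ballBeat a (r + 1) - ballBeat a r) : ℝ) = 0 := by linear_combination e1 - e2
  rcases mul_eq_zero.1 e6 with h0 | h0
  · linarith
  · exfalso
    have e7 : (ballBeat b (r + 1) : ℝ) - ballBeat b r = ballBeat a (r + 1) - ballBeat a r := by
      linarith
    rw [e7] at e1
    have := mul_right_cancel₀ (by linarith) e1
    linarith

/-! #### The change of hands between two rounds -/

/-- Until `a` is released, `b` is farther out. If both fly, the remaining times decide; if `a` is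
carried, it is within `c` of the wall, whereas `b` still has at least one unit of flight left, which
is more than `c` in distance. -/
theorem fromWall_lt_of_le (hs : S.IsSmall c d) {a b : S.pattern.Ball} {r : ℤ} {s : ℝ}
    (hab : slot (r + 1) a < slot (r + 1) b)
    (h₁ : (S.time (r + 1) : ℝ) - 1 ≤ s) (h : s ≤ ballBeat a (r + 1) + d / 2) :
    fromWall (r + 1) (position c d a s) < fromWall (r + 1) (position c d b s) := by
  have hd := hs.d_le
  have hd0 := hs.d_pos
  have hd1 := hs.d_lt_one
  have hc := hs.c_lt_half
  have hc0 := hs.c_pos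
  have e1 := ballBeat_le b (r + 1)
  have e2 := ballBeat_add_two_le hab
  have e3 := le_flightTime b r
  have e4 := flightTime_le b r
  have e5 := le_flightTime a r
  have e6 := flightTime_le a r
  have e7 := le_flight_real (S := S) r
  have e8 := flight_le_real (S := S) r
  have e9 := S.time_succ r
  have e10 : (S.time (r + 1) : ℝ) = S.time r + S.flight r := by exact_mod_cast e9
  have e11 := ballBeat_le b r
  have e12 := ballBeat_le a r
  have hn : (0 : ℝ) ≤ n := Nat.cast_nonneg n
  rw [fromWall_position_flight (b := b) hd0 hd1 (by linarith) (by linarith)]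
  rcases le_total s (ballBeat a (r + 1) - d / 2) with h' | h'
  · rw [fromWall_position_flight hd0 hd1 (by linarith) h']
    refine mul_lt_mul_of_pos_left (div_lt_div_of_near ?_ ?_ ?_ ?_ ?_) (by linarith) <;> linarith
  · rw [fromWall_position_carry hd0 hd1 h' h]
    have h1 : c * ((s - (ballBeat a (r + 1) - d / 2)) / d) ≤ c * 1 :=
      mul_le_mul_of_nonneg_left ((div_le_one hd0).2 (by linarith)) hc0.le
    have h2 : c < (1 - c) * ((ballBeat b (r + 1) - d / 2 - s) /
        (ballBeat b (r + 1) - ballBeat b r - d)) := by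
      rw [← mul_div_assoc, lt_div_iff₀ (by linarith)]
      have h3 : c * ((ballBeat b (r + 1) : ℝ) - ballBeat b r - d) ≤ c * (S.bound + 4) :=
        mul_le_mul_of_nonneg_left (by linarith) hc0.le
      have h4 : (1 - c) * 1 ≤ (1 - c) * (ballBeat b (r + 1) - d / 2 - s) :=
        mul_le_mul_of_nonneg_left (by linarith) (by linarith)
      linarith [hs.c_lt]
    linarith

/-- The mirror image in time: once `b` has been caught, the ball `a` thrown before it is farther
out. Together with `fromWall_lt_of_le` this confines a meeting to the time between the throw of `a`
and the catch of `b`. -/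
theorem fromWall_lt_of_ge (hs : S.IsSmall c d) {a b : S.pattern.Ball} {r : ℤ} {s : ℝ}
    (hab : slot r a < slot r b)
    (h₁ : s ≤ S.time r + 2 * n) (h : ballBeat b r - d / 2 ≤ s) :
    fromWall r (position c d b s) < fromWall r (position c d a s) := by
  have hd := hs.d_le
  have hd0 := hs.d_pos
  have hd1 := hs.d_lt_one
  have hc := hs.c_lt_half
  have hc0 := hs.c_pos
  have e1 := time_le_ballBeat a r
  have e2 := ballBeat_add_two_le hab
  have e3 := le_flightTime b r
  have e4 := flightTime_le b r
  have e5 := le_flightTime a r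
  have e6 := flightTime_le a r
  have e7 := le_flight_real (S := S) r
  have hn : (0 : ℝ) ≤ n := Nat.cast_nonneg n
  have e8 := ballBeat_le b r
  rw [fromWall_position_launch (b := a) hs (by linarith) (by linarith)]
  rcases le_total s (ballBeat b r + d / 2) with h' | h'
  · rw [fromWall_position_carry hd0 hd1 h h']
    have h1 : c * ((s - (ballBeat b r - d / 2)) / d) ≤ c * 1 :=
      mul_le_mul_of_nonneg_left ((div_le_one hd0).2 (by linarith)) hc0.le
    have h2 : 0 < (1 - c) * ((s - (ballBeat a r + d / 2)) /
        (ballBeat a (r + 1) - ballBeat a r - d)) :=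
      mul_pos (by linarith) (div_pos (by linarith) (by linarith))
    linarith
  · rw [fromWall_position_launch hs h' (by linarith)]
    refine add_lt_add_right (mul_lt_mul_of_pos_left
      (div_lt_div_of_near ?_ ?_ ?_ ?_ ?_) (by linarith)) _ <;> linarith

/-- Balls that meet while they change hands do so when the first one has been thrown and the second
one has not been caught yet. -/
theorem meet_turn (hs : S.IsSmall c d) {a b : S.pattern.Ball} {r : ℤ} {s : ℝ}
    (hab : slot (r + 1) a < slot (r + 1) b)
    (h₁ : (S.time (r + 1) : ℝ) - 1 ≤ s) (h₂ : s ≤ S.time (r + 1) + 2 * n)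
    (h : position c d a s = position c d b s) :
    ballBeat a (r + 1) + d / 2 < s ∧ s < ballBeat b (r + 1) - d / 2 ∧
      c + (1 - c) * ((s - (ballBeat a (r + 1) + d / 2)) /
        (ballBeat a (r + 1 + 1) - ballBeat a (r + 1) - d)) =
      (1 - c) * ((ballBeat b (r + 1) - d / 2 - s) / (ballBeat b (r + 1) - ballBeat b r - d)) := by
  have hd := hs.d_le
  have e1 : ballBeat a (r + 1) + d / 2 < s := by
    by_contra hcon
    have := fromWall_lt_of_le hs hab h₁ (not_lt.1 hcon)
    rw [h] at this
    exact lt_irrefl _ this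
  have e2 : s < ballBeat b (r + 1) - d / 2 := by
    by_contra hcon
    have := fromWall_lt_of_ge hs hab h₂ (not_lt.1 hcon)
    rw [h] at this
    exact lt_irrefl _ this
  refine ⟨e1, e2, ?_⟩
  have e3 := ballBeat_le b (r + 1)
  have e4 := time_le_ballBeat a (r + 1)
  have e5 := le_flightTime a (r + 1)
  have e6 := le_flightTime b r
  have e7 := le_flight_real (S := S) r
  have e8 := le_flight_real (S := S) (r + 1)
  have hn : (0 : ℝ) ≤ n := Nat.cast_nonneg n
  rw [← fromWall_position_launch hs e1.le (by linarith),
    ← fromWall_position_flight hs.d_pos hs.d_lt_one (by linarith [ballBeat_le b r,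
      (by exact_mod_cast S.time_succ r : (S.time (r + 1) : ℝ) = S.time r + S.flight r)]) e2.le, h]

theorem unique_meet_turn (hs : S.IsSmall c d) {a b : S.pattern.Ball} {r : ℤ} {s t : ℝ}
    (hab : slot (r + 1) a < slot (r + 1) b)
    (hs₁ : (S.time (r + 1) : ℝ) - 1 ≤ s) (hs₂ : s ≤ S.time (r + 1) + 2 * n)
    (ht₁ : (S.time (r + 1) : ℝ) - 1 ≤ t) (ht₂ : t ≤ S.time (r + 1) + 2 * n)
    (h : position c d a s = position c d b s) (h' : position c d a t = position c d b t) :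
    s = t := by
  obtain ⟨-, -, e1⟩ := meet_turn hs hab hs₁ hs₂ h
  obtain ⟨-, -, e2⟩ := meet_turn hs hab ht₁ ht₂ h'
  have hc := hs.c_lt_half
  have hd := hs.d_lt_one
  have p1 : 0 < (ballBeat a (r + 1 + 1) : ℝ) - ballBeat a (r + 1) - d := by
    linarith [ballBeat_add_le a (r + 1)]
  have p2 : 0 < (ballBeat b (r + 1) : ℝ) - ballBeat b r - d := by linarith [ballBeat_add_le b r]
  generalize (ballBeat a (r + 1 + 1) : ℝ) - ballBeat a (r + 1) - d = l at *
  generalize (ballBeat b (r + 1) : ℝ) - ballBeat b r - d = m at *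
  have e3 : (1 - c) * (s - t) * (1 / l + 1 / m) = 0 := by
    have := congrArg₂ (· - ·) e1 e2
    simp only [sub_div, add_div] at this
    linear_combination this
  have : 0 < 1 / l + 1 / m := by positivity
  rcases mul_eq_zero.1 e3 with h0 | h0
  · rcases mul_eq_zero.1 h0 with h0 | h0 <;> linarith
  · linarith

/-- At the meeting `a` is outgoing with the flight time of round `r + 1`, and `b` is incoming with
that of round `r`; the longer flight is higher. -/
theorem height_lt_of_meet_turn (hs : S.IsSmall c d) {a b : S.pattern.Ball} {r : ℤ} {s : ℝ}
    (hab : slot (r + 1) a < slot (r + 1) b)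
    (h₁ : (S.time (r + 1) : ℝ) - 1 ≤ s) (h₂ : s ≤ S.time (r + 1) + 2 * n)
    (h : position c d a s = position c d b s) :
    if S.flight r < S.flight (r + 1) then height d b s < height d a s
      else height d a s < height d b s := by
  obtain ⟨e1, e2, e3⟩ := meet_turn hs hab h₁ h₂ h
  have hc := hs.c_lt_half
  have hc0 := hs.c_pos
  have hd := hs.d_le
  have hd0 := hs.d_pos
  have i1 := ballBeat_le b (r + 1)
  have i2 := time_le_ballBeat a (r + 1)
  have i3 := ballBeat_add_two_le hab
  have i4 := le_flightTime b r
  have i5 := flightTime_le b r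
  have i6 := le_flightTime a (r + 1)
  have i7 := flightTime_le a (r + 1)
  have i8 := le_flight_real (S := S) r
  have i9 := le_flight_real (S := S) (r + 1)
  have i10 := flight_le_real (S := S) r
  have i11 := flight_le_real (S := S) (r + 1)
  have hn : (0 : ℝ) ≤ n := Nat.cast_nonneg n
  have i12 : (S.time (r + 1) : ℝ) = S.time r + S.flight r := by exact_mod_cast S.time_succ r
  have i13 := ballBeat_le b r
  rw [height_flight (b := a) hd0 hs.d_lt_one (r := r + 1) e1.le (by linarith),
    height_flight (b := b) hd0 hs.d_lt_one (r := r) (by linarith) e2.le]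
  have key := height_lt_of_opposite_direction hc0 hc hs.c_le (sub_pos.2 e1)
    (by linarith) (by linarith) (by linarith) (by linarith) (by linarith) (by linarith) e3
  rw [show (ballBeat a (r + 1 + 1) : ℝ) - ballBeat a (r + 1) - d -
    (s - (ballBeat a (r + 1) + d / 2)) = ballBeat a (r + 1 + 1) - d / 2 - s by ring,
    show (ballBeat b (r + 1) : ℝ) - ballBeat b r - d - (ballBeat b (r + 1) - d / 2 - s) =
      s - (ballBeat b r + d / 2) by ring,
    mul_comm (_ - d / 2 - s) (s - (ballBeat b r + d / 2))] at key
  -- Exchanges alter each flight time by at most 2, so the gap of 6 between rounds leaves the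
  -- difference of 2 that `key` requires.
  have hgap := S.gap r
  split_ifs with hlt
  · apply key.1
    have hgap' : S.flight r + 6 ≤ S.flight (r + 1) := by
      rw [abs_of_pos (by omega)] at hgap
      omega
    have i14 : (S.flight r : ℝ) + 6 ≤ S.flight (r + 1) := by exact_mod_cast hgap'
    linarith
  · apply key.2
    have hgap' : S.flight (r + 1) + 6 ≤ S.flight r := by
      rw [abs_of_nonpos (by omega)] at hgap
      omega
    have i14 : (S.flight (r + 1) : ℝ) + 6 ≤ S.flight r := by exact_mod_cast hgap'
    linarith

end Schedule

/-! ### The braid of a round -/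

namespace Schedule

open JugglingPattern

variable {n : ℕ} {S : Schedule n} {c d : ℝ}

/-- The slots of a round in the order of the positions of their balls before the change of hands
in that round. -/
def slotsBefore (n : ℕ) (r : ℤ) : List (Fin n) :=
  if Even r then List.finRange n else (List.finRange n).reverse

/-- The order of the heights while the balls change hands between the rounds `r` and `r + 1`. -/
def turnOrder (S : Schedule n) (r : ℤ) (k l : Fin n) : Prop :=
  if S.flight r < S.flight (r + 1) then k < l else l < k

instance (r : ℤ) : IsStrictTotalOrder (Fin n) (S.turnOrder r) := by
  by_cases h : S.flight r < S.flight (r + 1)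
  · rw [show S.turnOrder r = fun k l => k < l by ext; simp [turnOrder, h]]
    infer_instance
  · rw [show S.turnOrder r = fun k l => l < k by ext; simp [turnOrder, h]]
    infer_instance

variable (S) in
/-- The braid of the flights of a round, on `N = n` strands. -/
noncomputable def midBraid (N : ℕ) (r : ℤ) : BraidGroup N :=
  layerBraid N (· < ·) 0 (slotsBefore n r).reverse *
    -- Layers are named by the slots of round `r`. The slot `k` of round `r + 1` belongs to the ball
    -- that had the slot `(S.perm r).symm k`, and `slotsBefore n (r + 1)` is the reverse of
    -- `slotsBefore n r`.
    (layerBraid N (· < ·) 0 ((slotsBefore n r).reverse.map (S.perm r).symm))⁻¹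

variable (S) in
/-- The braid of the change of hands between the rounds `r` and `r + 1`, on `N = n` strands. -/
noncomputable def turnBraid (N : ℕ) (r : ℤ) : BraidGroup N :=
  layerBraid N (S.turnOrder r) 0 (slotsBefore n (r + 1)) *
    (layerBraid N (S.turnOrder r) 0 (slotsBefore n (r + 1)).reverse)⁻¹

theorem isStrictTotalOrder_slot (r : ℤ) (ov : Fin n → Fin n → Prop)
    [IsStrictTotalOrder (Fin n) ov] :
    IsStrictTotalOrder S.pattern.Ball fun a b => ov (slot r a) (slot r b) :=
  (RelIso.preimage (S.ballEquiv r).symm ov).toRelEmbedding.isStrictTotalOrder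

theorem fromWall_lt_iff_of_even {r : ℤ} (hr : Even r) {x y : ℝ} :
    fromWall r x < fromWall r y ↔ x < y := by
  simp [fromWall, hr]

theorem fromWall_lt_iff_of_odd {r : ℤ} (hr : ¬ Even r) {x y : ℝ} :
    fromWall r x < fromWall r y ↔ y < x := by
  simp [fromWall, hr]

theorem nodup_slotsBefore (r : ℤ) : (slotsBefore n r).Nodup := by
  unfold slotsBefore
  split_ifs
  · exact List.nodup_finRange n
  · exact List.nodup_reverse.2 (List.nodup_finRange n)

theorem mem_slotsBefore (r : ℤ) (k : Fin n) : k ∈ slotsBefore n r := by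
  unfold slotsBefore
  split_ifs <;> simp

theorem nodup_map_ballEquiv {l : List (Fin n)} (r : ℤ) (h : l.Nodup) :
    (l.map (S.ballEquiv r)).Nodup :=
  h.map (S.ballEquiv r).injective

theorem mem_map_ballEquiv {l : List (Fin n)} (r : ℤ) (h : ∀ k, k ∈ l) (b : S.pattern.Ball) :
    b ∈ l.map (S.ballEquiv r) :=
  List.mem_map.2 ⟨slot r b, h _, ballEquiv_slot r b⟩

theorem pairwise_slotsBefore {r : ℤ} {s : ℝ}
    (h : ∀ a b : S.pattern.Ball, slot r a < slot r b →
      fromWall r (position c d a s) < fromWall r (position c d b s)) :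
    ((slotsBefore n r).map (S.ballEquiv r)).Pairwise
      fun a b => position c d a s < position c d b s := by
  rw [List.pairwise_map]
  unfold slotsBefore
  split_ifs with hr
  · refine (List.pairwise_lt_finRange n).imp fun {k l} hkl => ?_
    exact (fromWall_lt_iff_of_even hr).1 (h _ _ (by simpa using hkl))
  · refine (pairwise_gt_reverse_finRange n).imp fun {k l} hkl => ?_
    exact (fromWall_lt_iff_of_odd hr).1 (h _ _ (by simpa using hkl))

theorem pairwise_slotsBefore_reverse {r : ℤ} {s : ℝ}
    (h : ∀ a b : S.pattern.Ball, slot r a < slot r b →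
      fromWall r (position c d b s) < fromWall r (position c d a s)) :
    ((slotsBefore n r).reverse.map (S.ballEquiv r)).Pairwise
      fun a b => position c d a s < position c d b s := by
  rw [List.pairwise_map]
  unfold slotsBefore
  split_ifs with hr
  · refine (pairwise_gt_reverse_finRange n).imp fun {k l} hkl => ?_
    exact (fromWall_lt_iff_of_even hr).1 (h _ _ (by simpa using hkl))
  · rw [List.reverse_reverse]
    refine (List.pairwise_lt_finRange n).imp fun {k l} hkl => ?_
    exact (fromWall_lt_iff_of_odd hr).1 (h _ _ (by simpa using hkl))

theorem position_lt_before (hs : S.IsSmall c d) (r : ℤ) (a b : S.pattern.Ball)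
    (hab : slot (r + 1) a < slot (r + 1) b) :
    fromWall (r + 1) (position c d a (S.time (r + 1) - 1)) <
      fromWall (r + 1) (position c d b (S.time (r + 1) - 1)) :=
  fromWall_lt_of_le hs hab le_rfl (by linarith [time_le_ballBeat a (r + 1), hs.d_pos])

theorem position_lt_after (hs : S.IsSmall c d) (r : ℤ) (a b : S.pattern.Ball)
    (hab : slot r a < slot r b) :
    fromWall r (position c d b (S.time r + 2 * n)) <
      fromWall r (position c d a (S.time r + 2 * n)) :=
  fromWall_lt_of_ge hs hab le_rfl (by linarith [ballBeat_le b r, hs.d_pos])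

theorem not_meet_before (hs : S.IsSmall c d) (r : ℤ) :
    ¬ S.pattern.Meet c d (S.time r - 1) := by
  rintro ⟨a, b, hab, h⟩
  obtain ⟨q, rfl⟩ : ∃ q, r = q + 1 := ⟨r - 1, by ring⟩
  rcases lt_or_gt_of_ne ((slot_injective (q + 1)).ne hab) with h' | h'
  · have := position_lt_before hs q a b h'
    rw [h] at this
    exact lt_irrefl _ this
  · have := position_lt_before hs q b a h'
    rw [h] at this
    exact lt_irrefl _ this

theorem not_meet_after (hs : S.IsSmall c d) (r : ℤ) :
    ¬ S.pattern.Meet c d (S.time r + 2 * n) := by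
  rintro ⟨a, b, hab, h⟩
  rcases lt_or_gt_of_ne ((slot_injective r).ne hab) with h' | h'
  · have := position_lt_after hs r a b h'
    rw [h] at this
    exact lt_irrefl _ this
  · have := position_lt_after hs r b a h'
    rw [h] at this
    exact lt_irrefl _ this

/-- There are finitely many pairs of balls, and each meets at most once in the window. -/
theorem finite_of_unique {A : Set ℝ} (r : ℤ)
    (hA : ∀ s ∈ A, S.pattern.Meet c d s)
    (h : ∀ a b : S.pattern.Ball, slot r a < slot r b → ∀ s ∈ A, ∀ t ∈ A,
      position c d a s = position c d b s → position c d a t = position c d b t → s = t) :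
    A.Finite := by
  have hsub : A ⊆ ⋃ x : S.pattern.Ball × S.pattern.Ball,
      {s | s ∈ A ∧ slot r x.1 < slot r x.2 ∧ position c d x.1 s = position c d x.2 s} := by
    intro s hs
    obtain ⟨a, b, hab, hp⟩ := hA s hs
    rw [Set.mem_iUnion]
    rcases lt_or_gt_of_ne ((slot_injective r).ne hab) with h' | h'
    · exact ⟨(a, b), hs, h', hp⟩
    · exact ⟨(b, a), hs, h', hp.symm⟩
  refine (Set.finite_iUnion fun x => Set.Subsingleton.finite ?_).subset hsub
  intro s hs t ht
  exact h x.1 x.2 hs.2.1 s hs.1 t ht.1 hs.2.2 ht.2.2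

theorem time_add_lt (r : ℤ) : (S.time r : ℝ) + 2 * n < S.time (r + 1) - 1 := by
  have h1 := le_flight_real (S := S) r
  have h2 : (S.time (r + 1) : ℝ) = S.time r + S.flight r := by exact_mod_cast S.time_succ r
  have hn : (0 : ℝ) ≤ n := Nat.cast_nonneg n
  linarith

theorem exists_midBraid (hs : S.IsSmall c d) (r : ℤ) :
    ∃ F : Finset ℝ, (∀ t, t ∈ F ↔ t ∈ Set.Ioo ((S.time r : ℝ) + 2 * n) (S.time (r + 1) - 1) ∧
      S.pattern.Meet c d t) ∧ S.pattern.braidAtTimes c d F = S.midBraid (Nat.card S.pattern.Ball) r := by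
  set A := {t | t ∈ Set.Ioo ((S.time r : ℝ) + 2 * n) (S.time (r + 1) - 1) ∧ S.pattern.Meet c d t}
    with hA
  have hfin : A.Finite := finite_of_unique r (fun s hs => hs.2) fun a b hab s h1 t h2 h3 h4 =>
    unique_meet_mid hs (by linarith [h1.1.1]) h1.1.2.le (by linarith [h2.1.1]) h2.1.2.le h3 h4 hab
  refine ⟨hfin.toFinset, fun t => by rw [hfin.mem_toFinset, hA]; rfl, ?_⟩
  have hL := isStrictTotalOrder_slot (S := S) r (· < ·)
  have hbefore : slotsBefore n (r + 1) = (slotsBefore n r).reverse := by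
    unfold slotsBefore
    by_cases hr : Even r <;> simp [hr]
  have hball : ∀ k, S.ballEquiv (r + 1) k = S.ballEquiv r ((S.perm r).symm k) := by
    intro k
    apply slot_injective (r + 1)
    rw [slot_ballEquiv, slot_succ, slot_ballEquiv, Equiv.apply_symm_apply]
  rw [braidAtTimes_eq_of_layers (continuous_position hs.d_pos hs.d_lt_one)
    (fun a b => slot r a < slot r b) hfin.toFinset (time_add_lt r)
    (fun t => by rw [hfin.mem_toFinset, hA]; rfl) ?_
    (nodup_map_ballEquiv r (List.nodup_reverse.2 (nodup_slotsBefore r)))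
    (mem_map_ballEquiv r fun k => List.mem_reverse.2 (mem_slotsBefore r k))
    (pairwise_slotsBefore_reverse (position_lt_after hs r))
    (nodup_map_ballEquiv (r + 1) (nodup_slotsBefore (r + 1)))
    (mem_map_ballEquiv (r + 1) (mem_slotsBefore (r + 1)))
    (pairwise_slotsBefore (position_lt_before hs r))]
  · rw [hbefore, show ((slotsBefore n r).reverse.map (S.ballEquiv (r + 1))) =
      ((slotsBefore n r).reverse.map (S.perm r).symm).map (S.ballEquiv r) by
        rw [List.map_map]; exact List.map_congr_left fun k _ => hball k, layerBraid_map,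
      layerBraid_map]
    simp only [slot_ballEquiv]
    rfl
  · intro t ht a b hab hp
    have h1 : (S.time r : ℝ) + 2 * n - 1 ≤ t := by linarith [ht.1]
    rcases lt_or_gt_of_ne ((slot_injective r).ne hab) with h' | h'
    · exact iff_of_true (height_lt_of_meet_mid hs h1 ht.2.le hp h') h'
    · exact iff_of_false (height_lt_of_meet_mid hs h1 ht.2.le hp.symm h').not_gt h'.not_gt

theorem exists_turnBraid (hs : S.IsSmall c d) (r : ℤ) :
    ∃ F : Finset ℝ,
      (∀ t, t ∈ F ↔ t ∈ Set.Ioo ((S.time (r + 1) : ℝ) - 1) (S.time (r + 1) + 2 * n) ∧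
        S.pattern.Meet c d t) ∧
      S.pattern.braidAtTimes c d F = S.turnBraid (Nat.card S.pattern.Ball) r := by
  set A := {t | t ∈ Set.Ioo ((S.time (r + 1) : ℝ) - 1) (S.time (r + 1) + 2 * n) ∧
    S.pattern.Meet c d t} with hA
  have hfin : A.Finite := finite_of_unique (r + 1) (fun s hs => hs.2)
    fun a b hab s h1 t h2 h3 h4 =>
      unique_meet_turn hs hab h1.1.1.le h1.1.2.le h2.1.1.le h2.1.2.le h3 h4
  refine ⟨hfin.toFinset, fun t => by rw [hfin.mem_toFinset, hA]; rfl, ?_⟩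
  have hL := isStrictTotalOrder_slot (S := S) (r + 1) (S.turnOrder r)
  have hn : (0 : ℝ) ≤ n := Nat.cast_nonneg n
  rw [braidAtTimes_eq_of_layers (continuous_position hs.d_pos hs.d_lt_one)
    (fun a b => S.turnOrder r (slot (r + 1) a) (slot (r + 1) b)) hfin.toFinset (by linarith)
    (fun t => by rw [hfin.mem_toFinset, hA]; rfl) ?_
    (nodup_map_ballEquiv (r + 1) (nodup_slotsBefore (r + 1)))
    (mem_map_ballEquiv (r + 1) (mem_slotsBefore (r + 1)))
    (pairwise_slotsBefore (position_lt_before hs r))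
    (nodup_map_ballEquiv (r + 1) (List.nodup_reverse.2 (nodup_slotsBefore (r + 1))))
    (mem_map_ballEquiv (r + 1) fun k => List.mem_reverse.2 (mem_slotsBefore (r + 1) k))
    (pairwise_slotsBefore_reverse (position_lt_after hs (r + 1)))]
  · rw [layerBraid_map, layerBraid_map]
    simp only [slot_ballEquiv]
    rfl
  · intro t ht a b hab hp
    unfold turnOrder IsAbove
    rcases lt_or_gt_of_ne ((slot_injective (r + 1)).ne hab) with h' | h'
    · have := height_lt_of_meet_turn hs h' ht.1.le ht.2.le hp
      split_ifs at this ⊢ with h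
      · exact iff_of_true this h'
      · exact iff_of_false this.not_gt h'.not_gt
    · have := height_lt_of_meet_turn hs h' ht.1.le ht.2.le hp.symm
      split_ifs at this ⊢ with h
      · exact iff_of_false this.not_gt h'.not_gt
      · exact iff_of_true this h'

/-- No balls meet at the ends of the two windows, so the open windows account for all crossings of a
half-open round, and the rounds fit together without gaps. -/
theorem exists_roundBraid (hs : S.IsSmall c d) (r : ℤ) :
    ∃ F : Finset ℝ,
      (∀ t, t ∈ F ↔ t ∈ Set.Ico ((S.time r : ℝ) + 2 * n) (S.time (r + 1) + 2 * n) ∧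
        S.pattern.Meet c d t) ∧
      S.pattern.braidAtTimes c d F = S.midBraid (Nat.card S.pattern.Ball) r *
        S.turnBraid (Nat.card S.pattern.Ball) r := by
  obtain ⟨F, hF, hF'⟩ := exists_midBraid hs r
  obtain ⟨G, hG, hG'⟩ := exists_turnBraid hs r
  have hn : (0 : ℝ) ≤ n := Nat.cast_nonneg n
  have hr := time_add_lt (S := S) r
  refine ⟨F ∪ G, fun t => ?_, ?_⟩
  · rw [Finset.mem_union, hF, hG]
    constructor
    · rintro (⟨h, hm⟩ | ⟨h, hm⟩)
      · exact ⟨⟨h.1.le, by linarith [h.2]⟩, hm⟩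
      · exact ⟨⟨by linarith [h.1], h.2⟩, hm⟩
    · rintro ⟨h, hm⟩
      have h1 : t ≠ S.time r + 2 * n := fun h => not_meet_after hs r (h ▸ hm)
      have h2 : t ≠ S.time (r + 1) - 1 := fun h => not_meet_before hs (r + 1) (h ▸ hm)
      rcases lt_or_gt_of_ne h2 with h3 | h3
      · exact Or.inl ⟨⟨lt_of_le_of_ne h.1 h1.symm, h3⟩, hm⟩
      · exact Or.inr ⟨⟨h3, h.2⟩, hm⟩
  · rw [← hF', ← hG']
    refine braidAtTimes_union (fun t => Finset.mem_union) fun s hs t ht => ?_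
    exact ((hF s).1 hs).1.2.trans ((hG t).1 ht).1.1

theorem time_le_time {r s : ℤ} (h : r ≤ s) : (S.time r : ℝ) ≤ S.time s := by
  rcases h.eq_or_lt with rfl | h
  · rfl
  · have h1 := S.time_add_le h
    have h2 : S.time r ≤ S.time s := by omega
    exact_mod_cast h2

theorem exists_braidAtTimes (hs : S.IsSmall c d) (m : ℕ) :
    ∃ F : Finset ℝ,
      (∀ t, t ∈ F ↔ t ∈ Set.Ico ((S.time 0 : ℝ) + 2 * n) (S.time m + 2 * n) ∧
        S.pattern.Meet c d t) ∧
      S.pattern.braidAtTimes c d F = ((List.range m).map fun r : ℕ =>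
        S.midBraid (Nat.card S.pattern.Ball) r * S.turnBraid (Nat.card S.pattern.Ball) r).prod := by
  induction m with
  | zero => exact ⟨∅, by simp, by simp [braidAtTimes]⟩
  | succ m ih =>
    obtain ⟨F, hF, hF'⟩ := ih
    obtain ⟨G, hG, hG'⟩ := exists_roundBraid hs m
    have h0 : (S.time 0 : ℝ) ≤ S.time m := time_le_time (by omega)
    have h1 : (S.time m : ℝ) ≤ S.time (m + 1) := time_le_time (by omega)
    refine ⟨F ∪ G, fun t => ?_, ?_⟩
    · rw [Finset.mem_union, hF, hG, ← or_and_right]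
      refine and_congr_left fun _ => ?_
      push_cast
      simp only [Set.mem_Ico]
      constructor
      · rintro (h | h)
        · exact ⟨h.1, by linarith⟩
        · exact ⟨by linarith, h.2⟩
      · rintro ⟨h2, h3⟩
        rcases lt_or_ge t (S.time m + 2 * n) with h4 | h4
        · exact Or.inl ⟨h2, h4⟩
        · exact Or.inr ⟨h4, h3⟩
    · rw [List.range_succ, List.map_append, List.prod_append, ← hF', List.map_singleton,
        List.prod_singleton, ← hG']
      refine braidAtTimes_union (fun t => Finset.mem_union) fun s hs t ht => ?_
      exact ((hF s).1 hs).1.2.trans_le ((hG t).1 ht).1.1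

theorem exists_time_window (S : Schedule n) (s : ℝ) :
    ∃ r, (S.time r : ℝ) + 2 * n ≤ s ∧ s < S.time (r + 1) + 2 * n := by
  have hlow : ∀ m : ℕ, S.time (-(m : ℤ)) ≤ S.time 0 - m := by
    intro m
    induction m with
    | zero => simp
    | succ m ih =>
      have := S.time_add_le (show -((m + 1 : ℕ) : ℤ) < -(m : ℤ) by omega)
      omega
  have hhigh : ∀ m : ℕ, S.time 0 + m ≤ S.time m := by
    intro m
    induction m with
    | zero => simp
    | succ m ih =>
      have := S.time_add_le (show (m : ℤ) < (m + 1 : ℕ) by omega)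
      omega
  have hmono : ∀ {r q : ℤ}, r < q → S.time r < S.time q := fun h => by
    have := S.time_add_le h
    omega
  obtain ⟨r, hr, hmax⟩ := Int.exists_greatest_of_bdd
    (P := fun r => S.time r + 2 * n ≤ ⌊s⌋)
    ⟨(⌊s⌋ - S.time 0).natAbs, fun r hr => by
      by_contra hcon
      have h1 := hhigh (⌊s⌋ - S.time 0).natAbs
      have h2 := hmono (not_le.1 hcon)
      omega⟩
    ⟨-((⌊s⌋ - S.time 0 - 2 * n).natAbs : ℤ), by
      have := hlow (⌊s⌋ - S.time 0 - 2 * n).natAbs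
      omega⟩
  refine ⟨r, ?_, ?_⟩
  · have := Int.le_floor.1 hr
    push_cast at this
    exact this
  · have : ⌊s⌋ < S.time (r + 1) + 2 * n := by
      by_contra hcon
      have := hmax _ (not_lt.1 hcon)
      omega
    have := Int.floor_lt.1 this
    push_cast at this
    exact this

/-- The windows cover all times, and in each of them the heights at a meeting are strictly ordered.
-/
theorem collisionFree (hs : S.IsSmall c d) : S.pattern.CollisionFree c d := by
  intro s a b hab hp
  obtain ⟨r, h1, h2⟩ := exists_time_window S s
  rcases le_total s (S.time (r + 1) - 1) with h | h
  · have h1' : (S.time r : ℝ) + 2 * n - 1 ≤ s := by linarith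
    rcases lt_or_gt_of_ne ((slot_injective r).ne hab) with h' | h'
    · exact (height_lt_of_meet_mid hs h1' h hp h').ne'
    · exact (height_lt_of_meet_mid hs h1' h hp.symm h').ne
  · rcases lt_or_gt_of_ne ((slot_injective (r + 1)).ne hab) with h' | h'
    · have := height_lt_of_meet_turn hs h' h h2.le hp
      split_ifs at this
      · exact this.ne'
      · exact this.ne
    · have := height_lt_of_meet_turn hs h' h h2.le hp.symm
      split_ifs at this
      · exact this.ne
      · exact this.ne'

end Schedule

/-! ### Periodic sequences -/

/-- The sum of the first `r` values of the periodic continuation of `f 0, …, f (R - 1)` to the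
integers. -/
def cyclicSum (R : ℕ) (f : ℕ → ℤ) (r : ℤ) : ℤ :=
  (∑ i ∈ Finset.range R, f i) * (r / R) + ∑ i ∈ Finset.range (r % R).toNat, f i

theorem emod_add_one_cases {R : ℕ} (hR : 0 < R) (r : ℤ) :
    ((r % R).toNat + 1 < R ∧ ((r + 1) % R).toNat = (r % R).toNat + 1 ∧ (r + 1) / R = r / R) ∨
      ((r % R).toNat + 1 = R ∧ ((r + 1) % R).toNat = 0 ∧ (r + 1) / R = r / R + 1) := by
  have h0 := Int.emod_nonneg r (by omega : (R : ℤ) ≠ 0)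
  have h1 := Int.emod_lt_of_pos r (by omega : (0 : ℤ) < R)
  have h2 := Int.emod_add_mul_ediv r R
  generalize r % (R : ℤ) = a at *
  generalize r / (R : ℤ) = q at *
  by_cases h : a + 1 < R
  · left
    have e1 : (r + 1) / R = q ∧ (r + 1) % R = a + 1 := by
      rw [Int.ediv_emod_unique (by omega)]
      exact ⟨by rw [← h2]; ring, by omega, h⟩
    rw [e1.1, e1.2]
    exact ⟨by omega, by omega, rfl⟩
  · right
    have hRa : (R : ℤ) = a + 1 := by omega
    have e1 : (r + 1) / R = q + 1 ∧ (r + 1) % R = 0 := by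
      rw [Int.ediv_emod_unique (by omega)]
      exact ⟨by rw [← h2, mul_add, mul_one]; omega, le_rfl, by omega⟩
    rw [e1.1, e1.2]
    exact ⟨by omega, rfl, rfl⟩

theorem cyclicSum_succ {R : ℕ} (hR : 0 < R) (f : ℕ → ℤ) (r : ℤ) :
    cyclicSum R f (r + 1) = cyclicSum R f r + f (r % R).toNat := by
  unfold cyclicSum
  rcases emod_add_one_cases hR r with ⟨-, h1, h2⟩ | ⟨h0, h1, h2⟩
  · rw [h1, h2, Finset.sum_range_succ]
    ring
  · rw [h1, h2, Finset.sum_range_zero]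
    -- At the wrap-around the sum of a full period is the previous partial sum and its last term.
    conv_lhs => rw [← h0, Finset.sum_range_succ, h0]
    conv_rhs => rw [← h0, Finset.sum_range_succ, h0]
    ring

theorem cyclicSum_add {R : ℕ} (hR : 0 < R) (f : ℕ → ℤ) (r : ℤ) :
    cyclicSum R f (r + R) = cyclicSum R f r + ∑ i ∈ Finset.range R, f i := by
  unfold cyclicSum
  rw [Int.add_emod_right, Int.add_ediv_of_dvd_right (dvd_refl _), Int.ediv_self (by omega)]
  ring

theorem cyclicSum_zero (R : ℕ) (f : ℕ → ℤ) : cyclicSum R f 0 = 0 := by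
  simp [cyclicSum]

theorem even_cyclicSum {R : ℕ} (hR : 0 < R) {f : ℕ → ℤ} (hf : ∀ i, Odd (f i)) (r : ℤ) :
    Even (cyclicSum R f r) ↔ Even r := by
  have hstep : ∀ r, (Even (cyclicSum R f (r + 1)) ↔ ¬ Even (cyclicSum R f r)) := by
    intro r
    rw [cyclicSum_succ hR, Int.even_add]
    have := Int.not_even_iff_odd.2 (hf (r % R).toNat)
    tauto
  induction r using Int.induction_on with
  | zero => simp [cyclicSum_zero]
  | succ i ih => rw [hstep, Int.even_add_one]; exact not_congr ih
  | pred i ih =>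
    have h1 := hstep (-(i : ℤ) - 1)
    rw [sub_add_cancel] at h1
    rw [Int.even_sub_one, ← not_iff_not, ← h1, not_not]
    exact ih

/-! ### The schedule of a braid word -/

variable (n : ℕ) (w : List (ℕ × Bool))

/-- The flight times in the rounds of a period. Two rounds are spent on each letter of the word,
and four rounds follow. -/
def wordFlight (i : ℕ) : ℤ :=
  -- The values rise in steps of 6 up to the index `2 * w.length + 2`. The last value is 6 above the
  -- value at index 0 and at least 6 below its predecessor, so the cycle has exactly two descents,
  -- one directly after the other. All values are odd, so that the hands alternate.
  if i = 2 * w.length + 3 then 16 * n + 15 else 16 * n + 9 + 6 * i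

theorem odd_wordFlight (i : ℕ) : Odd (wordFlight n w i) := by
  unfold wordFlight
  split_ifs
  · exact ⟨8 * n + 7, by ring⟩
  · exact ⟨8 * n + 4 + 3 * i, by ring⟩

/-- The exchange of two balls that yields a given letter: a positive letter in an odd round, a
negative one in an even round. -/
def letterPerm (odd : Bool) : Option (ℕ × Bool) → Equiv.Perm (Fin n)
  | none => 1
  | some (j, b) =>
    if h : j + 1 < n ∧ b = odd then
      -- In flight the slots `i` and `i + 1` of an even round lie at the positions `n - 1 - i` and
      -- `n - 2 - i`. In an odd round they lie at `i` and `i + 1`, but the surrounding half twists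
      -- mirror the letter. Either way `i = n - 2 - j` gives a letter at `j`.
      Equiv.swap ⟨n - 2 - j, by omega⟩ ⟨n - 2 - j + 1, by omega⟩
    else 1

theorem letterPerm_near (o : Bool) (x : Option (ℕ × Bool)) (k : Fin n) :
    |((letterPerm n o x k : ℕ) : ℤ) - (k : ℕ)| ≤ 1 := by
  rcases x with _ | ⟨j, b⟩
  · simp [letterPerm]
  · simp only [letterPerm]
    split_ifs with h
    · rw [Equiv.swap_apply_def]
      split_ifs with h1 h2
      · rw [h1]; simp
      · rw [h2]; simp
      · simp
    · simp

theorem letterPerm_symm (o : Bool) (x : Option (ℕ × Bool)) :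
    (letterPerm n o x).symm = letterPerm n o x := by
  rcases x with _ | ⟨j, b⟩
  · rfl
  · simp only [letterPerm]
    split_ifs
    · exact Equiv.symm_swap _ _
    · rfl

/-- The exchange of balls in a round of a period. -/
def wordPerm (i : ℕ) : Equiv.Perm (Fin n) := letterPerm n (decide (i % 2 = 1)) w[i / 2]?

theorem wordFlight_le (i : ℕ) (hi : i < 2 * w.length + 4) :
    wordFlight n w i ≤ 16 * n + 9 + 6 * (2 * w.length + 2) := by
  unfold wordFlight
  split_ifs
  · omega
  · omega

theorem le_wordFlight (i : ℕ) : 16 * (n : ℤ) + 9 ≤ wordFlight n w i := by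
  unfold wordFlight
  split_ifs <;> omega

theorem sum_wordFlight_pos :
    0 < ∑ i ∈ Finset.range (2 * w.length + 4), wordFlight n w i :=
  Finset.sum_pos (fun i _ => by have := le_wordFlight n w i; omega) ⟨0, by simp⟩

theorem wordFlight_gap (r : ℤ) :
    6 ≤ |wordFlight n w ((r + 1) % (2 * w.length + 4 : ℕ)).toNat -
      wordFlight n w (r % (2 * w.length + 4 : ℕ)).toNat| := by
  rcases emod_add_one_cases (by omega : 0 < 2 * w.length + 4) r with ⟨h0, h1, -⟩ | ⟨h0, h1, -⟩
  · rw [h1, le_abs]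
    generalize (r % (2 * w.length + 4 : ℕ)).toNat = i at *
    unfold wordFlight
    split_ifs <;> push_cast <;> omega
  · rw [h1, le_abs]
    generalize (r % (2 * w.length + 4 : ℕ)).toNat = i at *
    rw [wordFlight, wordFlight, if_neg (by omega), if_pos (by omega)]
    omega

/-- The schedule of a pattern whose braid is spelled by a given word. -/
def wordSchedule : Schedule n where
  -- Windows of rounds begin at `time r + 2 * n`; the shift makes that of round 0 begin at time 0,
  -- like the fundamental chamber.
  time r := cyclicSum (2 * w.length + 4) (wordFlight n w) r - 2 * n
  flight r := wordFlight n w (r % (2 * w.length + 4 : ℕ)).toNat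
  perm r := wordPerm n w (r % (2 * w.length + 4 : ℕ)).toNat
  bound := 16 * n + 9 + 6 * (2 * w.length + 2)
  rounds := 2 * w.length + 4
  length := (∑ i ∈ Finset.range (2 * w.length + 4), wordFlight n w i).toNat
  time_succ r := by rw [cyclicSum_succ (by omega)]; ring
  even_time r := by
    rw [Int.even_sub, even_cyclicSum (by omega) (odd_wordFlight n w)]
    simp
  le_flight r := by have := le_wordFlight n w (r % (2 * w.length + 4 : ℕ)).toNat; omega
  flight_le r := wordFlight_le n w _ (by
    have := Int.emod_lt_of_pos r (by omega : (0 : ℤ) < (2 * w.length + 4 : ℕ))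
    omega)
  gap r := wordFlight_gap n w r
  perm_near r k := letterPerm_near n _ _ k
  length_pos := by have := sum_wordFlight_pos n w; omega
  time_periodic r := by
    rw [cyclicSum_add (by omega), Int.toNat_of_nonneg (sum_wordFlight_pos n w).le]
    ring
  perm_periodic r := by rw [Int.add_emod_right]

theorem wordSchedule_flight {i : ℕ} (h : i < 2 * w.length + 4) :
    (wordSchedule n w).flight i = wordFlight n w i := by
  change wordFlight n w ((i : ℤ) % (2 * w.length + 4 : ℕ)).toNat = _
  rw [Int.emod_eq_of_lt (by omega) (by omega), Int.toNat_natCast]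

theorem wordSchedule_perm {i : ℕ} (h : i < 2 * w.length + 4) :
    (wordSchedule n w).perm i = wordPerm n w i := by
  change wordPerm n w ((i : ℤ) % (2 * w.length + 4 : ℕ)).toNat = _
  rw [Int.emod_eq_of_lt (by omega) (by omega), Int.toNat_natCast]

variable {n w}

theorem wordSchedule_flight_lt {i : ℕ} (h : i < 2 * w.length + 2) :
    (wordSchedule n w).flight i < (wordSchedule n w).flight (i + 1) := by
  have h1 := wordSchedule_flight n w (i := i + 1) (by omega)
  push_cast at h1
  rw [wordSchedule_flight n w (by omega), h1, wordFlight, wordFlight, if_neg (by omega),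
    if_neg (by omega)]
  push_cast
  omega

theorem not_wordSchedule_flight_lt {i : ℕ} (h : 2 * w.length + 2 ≤ i)
    (h' : i < 2 * w.length + 4) :
    ¬ (wordSchedule n w).flight i < (wordSchedule n w).flight (i + 1) := by
  have h2 : (wordSchedule n w).flight (i + 1) =
      wordFlight n w (if i = 2 * w.length + 2 then i + 1 else 0) := by
    split_ifs with h
    · have h1 := wordSchedule_flight n w (i := i + 1) (by omega)
      push_cast at h1
      exact h1
    · change wordFlight n w (((i : ℤ) + 1) % (2 * w.length + 4 : ℕ)).toNat = _
      rw [show (i : ℤ) + 1 = (2 * w.length + 4 : ℕ) by omega, Int.emod_self, Int.toNat_zero]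
  rw [wordSchedule_flight n w h', h2]
  unfold wordFlight
  split_ifs <;> push_cast <;> omega

/-! ### The braids of the rounds and their product -/

open Schedule

/-- The flight time grows, so earlier slots are above. The list after the change already lies in the
order of the layers, and only the first factor of `turnBraid` is left; in an odd round it is the
second one. -/
theorem turnBraid_even {q : ℕ} (h : q ≤ w.length) :
    (wordSchedule n w).turnBraid n ((2 * q : ℕ) : ℤ) = halfTwist n := by
  have h1 := wordSchedule_flight_lt (n := n) (w := w) (i := 2 * q) (by omega)
  have h2 : (wordSchedule n w).turnOrder ((2 * q : ℕ) : ℤ) = fun k l => k < l := by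
    ext; simp only [turnOrder, if_pos h1]
  have h3 : slotsBefore n (((2 * q : ℕ) : ℤ) + 1) = (List.finRange n).reverse := by
    rw [slotsBefore, if_neg (by simp)]
  rw [turnBraid, h2, h3, List.reverse_reverse, layerBraid_lt_finRange,
    layerBraid_lt_reverse_finRange]
  simp

theorem turnBraid_odd {q : ℕ} (h : q ≤ w.length) :
    (wordSchedule n w).turnBraid n ((2 * q + 1 : ℕ) : ℤ) = (halfTwist n)⁻¹ := by
  have h1 := wordSchedule_flight_lt (n := n) (w := w) (i := 2 * q + 1) (by omega)
  have h2 : (wordSchedule n w).turnOrder ((2 * q + 1 : ℕ) : ℤ) = fun k l => k < l := by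
    ext; simp only [turnOrder, if_pos h1]
  have h3 : slotsBefore n (((2 * q + 1 : ℕ) : ℤ) + 1) = List.finRange n := by
    rw [slotsBefore, if_pos (by simp)]
  rw [turnBraid, h2, h3, layerBraid_lt_finRange, layerBraid_lt_reverse_finRange, one_mul]

/-- The flight time drops, which reverses the layers and hence the sign of the half twist. -/
theorem turnBraid_even_last :
    (wordSchedule n w).turnBraid n ((2 * (w.length + 1) : ℕ) : ℤ) = (halfTwist n)⁻¹ := by
  have h1 := not_wordSchedule_flight_lt (n := n) (w := w) (i := 2 * (w.length + 1)) (by omega)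
    (by omega)
  have h2 : (wordSchedule n w).turnOrder ((2 * (w.length + 1) : ℕ) : ℤ) = fun k l => l < k := by
    ext; simp only [turnOrder, if_neg h1]
  have h3 : slotsBefore n (((2 * (w.length + 1) : ℕ) : ℤ) + 1) = (List.finRange n).reverse := by
    rw [slotsBefore, if_neg (by rw [Int.even_add_one, not_not]; exact ⟨w.length + 1, by push_cast; ring⟩)]
  rw [turnBraid, h2, h3, List.reverse_reverse, layerBraid_gt_reverse_finRange, one_mul]
  rfl

theorem turnBraid_odd_last :
    (wordSchedule n w).turnBraid n ((2 * (w.length + 1) + 1 : ℕ) : ℤ) = halfTwist n := by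
  have h1 := not_wordSchedule_flight_lt (n := n) (w := w) (i := 2 * (w.length + 1) + 1) (by omega)
    (by omega)
  have h2 : (wordSchedule n w).turnOrder ((2 * (w.length + 1) + 1 : ℕ) : ℤ) =
      fun k l => l < k := by
    ext; simp only [turnOrder, if_neg h1]
  have h3 : slotsBefore n (((2 * (w.length + 1) + 1 : ℕ) : ℤ) + 1) = List.finRange n := by
    rw [slotsBefore, if_pos ⟨w.length + 2, by push_cast; ring⟩]
  rw [turnBraid, h2, h3, layerBraid_gt_reverse_finRange, inv_one, mul_one]
  rfl

/-- The ball thrown first is ahead, that is, at the greater position, and passes over: a negative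
letter. Letters out of range are trivial braids and need no exchange. -/
theorem midBraid_even {q : ℕ} (h : q < w.length + 2) :
    (wordSchedule n w).midBraid n ((2 * q : ℕ) : ℤ) =
      (w[q]?.elim 1 fun x => if x.2 then 1 else braidLetter n x.1 x.2) := by
  have h3 : slotsBefore n ((2 * q : ℕ) : ℤ) = List.finRange n := by
    rw [slotsBefore, if_pos (by simp)]
  rw [midBraid, h3, wordSchedule_perm n w (by omega), wordPerm, letterPerm_symm]
  rw [show 2 * q / 2 = q by omega, show decide (2 * q % 2 = 1) = false by simp]
  rcases w[q]? with _ | ⟨j, b⟩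
  · simp [letterPerm]
  · cases b with
    | true => simp [letterPerm]
    | false =>
      simp only [letterPerm, and_true, Option.elim_some, Bool.false_eq_true, if_false]
      split_ifs with hj
      · rw [layerBraid_reverse_finRange_swap (i := n - 2 - j) (by omega) (· < ·),
          mul_inv_cancel_right, show n - 2 - (n - 2 - j) = j by omega]
        congr 1
        simp
      · simp [braidLetter_of_le (by omega : n ≤ j + 1)]

/-- Now the ball ahead is at the smaller position, so the letter is positive; it sits at the
mirrored place and is written as a conjugate by the half twist. -/
theorem midBraid_odd {q : ℕ} (h : q < w.length + 2) :
    (wordSchedule n w).midBraid n ((2 * q + 1 : ℕ) : ℤ) =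
      (halfTwist n)⁻¹ * (w[q]?.elim 1 fun x => if x.2 then braidLetter n x.1 x.2 else 1) *
        halfTwist n := by
  have h3 : slotsBefore n ((2 * q + 1 : ℕ) : ℤ) = (List.finRange n).reverse := by
    rw [slotsBefore, if_neg (by simp)]
  rw [midBraid, h3, wordSchedule_perm n w (by omega), wordPerm, letterPerm_symm]
  rw [show (2 * q + 1) / 2 = q by omega, show decide ((2 * q + 1) % 2 = 1) = true by
    simp, List.reverse_reverse]
  rcases w[q]? with _ | ⟨j, b⟩
  · simp [letterPerm]
  · cases b with
    | false => simp [letterPerm]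
    | true =>
      simp only [letterPerm, and_true, Option.elim_some, if_true]
      split_ifs with hj
      · rw [layerBraid_finRange_swap (i := n - 2 - j) (by omega) (· < ·), mul_inv_cancel_right]
        have h4 := braidGen_mul_halfTwist (n := n) (i := j) hj
        rw [mul_assoc, braidLetter, braidLetter, if_pos rfl, h4, inv_mul_cancel_left,
          if_pos (by simp)]
      · simp [braidLetter_of_le (by omega : n ≤ j + 1)]

theorem List.prod_map_range_two_mul {M : Type*} [Monoid M] (f : ℕ → M) (m : ℕ) :
    ((List.range (2 * m)).map f).prod =
      ((List.range m).map fun q => f (2 * q) * f (2 * q + 1)).prod := by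
  induction m with
  | zero => simp
  | succ m ih =>
    rw [show 2 * (m + 1) = 2 * m + 1 + 1 by ring, List.range_succ, List.range_succ,
      List.range_succ]
    simp [ih]

theorem braidOfWord_eq_prod_range (n : ℕ) (w : List (ℕ × Bool)) :
    ((List.range w.length).map fun q => w[q]?.elim 1 fun x => braidLetter n x.1 x.2).prod =
      braidOfWord n w := by
  induction w with
  | nil => simp
  | cons x w ih =>
    rw [List.length_cons, List.range_succ_eq_map, List.map_cons, List.prod_cons, List.map_map,
      braidOfWord_cons, ← ih]
    rfl

/-- Rounds are taken in pairs. The half twists after the even and the odd round cancel around the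
conjugated letter, and the last two pairs, which carry no letters, give 1 each. -/
theorem prod_rounds (n : ℕ) (w : List (ℕ × Bool)) :
    ((List.range (2 * w.length + 4)).map fun r : ℕ =>
      (wordSchedule n w).midBraid n r * (wordSchedule n w).turnBraid n r).prod =
      braidOfWord n w := by
  rw [show 2 * w.length + 4 = 2 * (w.length + 2) by ring, List.prod_map_range_two_mul,
    ← braidOfWord_eq_prod_range, List.range_succ, List.range_succ]
  simp only [List.map_append, List.map_singleton, List.prod_append, List.prod_singleton]
  rw [midBraid_even (q := w.length) (by omega), midBraid_odd (q := w.length) (by omega),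
    midBraid_even (q := w.length + 1) (by omega), midBraid_odd (q := w.length + 1) (by omega),
    turnBraid_even le_rfl, turnBraid_odd le_rfl, turnBraid_even_last, turnBraid_odd_last]
  rw [List.getElem?_eq_none le_rfl, List.getElem?_eq_none (Nat.le_succ _)]
  simp only [Option.elim_none, mul_one, one_mul, inv_mul_cancel, mul_inv_cancel]
  congr 1
  refine List.map_congr_left fun q hq => ?_
  have hq : q < w.length := List.mem_range.1 hq
  rw [midBraid_even (by omega), midBraid_odd (by omega), turnBraid_even hq.le,
    turnBraid_odd hq.le]
  rcases w[q]? with _ | ⟨j, b⟩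
  · simp
  · cases b <;> simp

/-! ### The exact period -/

namespace Schedule

variable (S : Schedule n)

theorem throw_beat (x : ℤ × Fin n) :
    S.pattern.f (S.beat x) - S.beat x =
      S.flight x.1 + 2 * ((S.perm x.1 x.2 : ℕ) : ℤ) - 2 * (x.2 : ℕ) := by
  rw [pattern_f_beat]
  simp only [beat, next, Equiv.coe_fn_mk, S.time_succ]
  ring

theorem time_sub_two_notMem (r : ℤ) : S.time r - 2 ∉ Set.range S.beat := by
  rintro ⟨⟨q, k⟩, h⟩
  simp only [beat] at h
  have hk := k.2
  rcases lt_or_ge q r with hq | hq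
  · have := S.time_add_le hq
    omega
  · rcases hq.eq_or_lt with rfl | hq
    · omega
    · have := S.time_add_le hq
      omega

end Schedule

/-- The greatest throw value `H` occurs in the rounds congruent to `M` only, and at all `n` slots of
these. A period carries such a block of throws to another one, and it cannot shift a block partly
into itself. -/
theorem exactPeriod_wordSchedule (hn : 0 < n) :
    (wordSchedule n w).pattern.exactPeriod = (wordSchedule n w).length := by
  set S := wordSchedule n w with hS
  have hmem : S.length ∈ {m : ℕ | 0 < m ∧ ∀ t, S.pattern.f (t + m) - (t + m) =
      S.pattern.f t - t} := by
    refine ⟨S.length_pos, fun t => ?_⟩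
    have : S.pattern.f (t + S.length) = S.pattern.f t + S.length := S.throwPerm_add_length t
    rw [this]
    ring
  refine le_antisymm (Nat.sInf_le hmem) (le_csInf ⟨_, hmem⟩ ?_)
  rintro m ⟨hm, hper⟩
  set M : ℕ := 2 * w.length + 2 with hM
  set H : ℤ := 16 * n + 9 + 6 * M with hH
  -- Exchanges change a throw by at most 2, while the flight times of the other rounds are at least
  -- 6 smaller.
  have hmax : ∀ x : ℤ × Fin n, S.pattern.f (S.beat x) - S.beat x = H →
      (x.1 % (2 * w.length + 4 : ℕ)) = M := by
    rintro ⟨r, k⟩ hx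
    rw [throw_beat] at hx
    have h1 := abs_le.1 (S.perm_near r k)
    have h2 : S.flight r = wordFlight n w (r % (2 * w.length + 4 : ℕ)).toNat := rfl
    have h3 := Int.emod_nonneg r (by omega : ((2 * w.length + 4 : ℕ) : ℤ) ≠ 0)
    have h4 := Int.emod_lt_of_pos r (by omega : (0 : ℤ) < (2 * w.length + 4 : ℕ))
    simp only at hx ⊢
    rw [h2, wordFlight] at hx
    split_ifs at hx <;> omega
  have hthrow : ∀ k : Fin n, S.pattern.f (S.beat (M, k)) - S.beat (M, k) = H := by
    intro k
    rw [throw_beat]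
    simp only
    rw [hS, wordSchedule_flight n w (by omega), wordSchedule_perm n w (by omega), wordPerm,
      List.getElem?_eq_none (by omega), wordFlight, if_neg (by omega)]
    simp [letterPerm, hH]
  have h1 := hper (S.beat (M, ⟨0, hn⟩))
  rw [hthrow] at h1
  have hr : S.beat (M, ⟨0, hn⟩) + m ∈ Set.range S.beat := by
    by_contra hcon
    have : S.pattern.f (S.beat (M, ⟨0, hn⟩) + m) = _ := S.throwPerm_of_notMem hcon
    omega
  obtain ⟨⟨r, k⟩, hrk⟩ := hr
  rw [← hrk] at h1
  have hmod := hmax _ h1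
  simp only at hmod
  have hk := k.2
  simp only [beat] at hrk
  push_cast at hrk
  rcases lt_trichotomy r M with hlt | rfl | hgt
  · have := S.time_add_le hlt
    omega
  -- A shift within the block would move the empty beat two before its start onto a throw of value
  -- `H`.
  · exfalso
    have h2 := hper (S.time M - 2)
    have h3 : S.pattern.f (S.time M - 2) = _ := S.throwPerm_of_notMem (S.time_sub_two_notMem M)
    have h4 : S.time M - 2 + m = S.beat (M, ⟨k - 1, by omega⟩) := by
      simp only [beat]
      omega
    rw [h4, hthrow, h3] at h2
    omega
  -- A later round congruent to `M` is at least a full cycle of rounds away.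
  · have h5 : (M : ℤ) + S.rounds ≤ r := by
      have h6 := Int.emod_add_mul_ediv r (2 * w.length + 4 : ℕ)
      have h7 : 0 < r / (2 * w.length + 4 : ℕ) := by
        by_contra hcon
        have : ((2 * w.length + 4 : ℕ) : ℤ) * (r / (2 * w.length + 4 : ℕ)) ≤ 0 :=
          mul_nonpos_of_nonneg_of_nonpos (by omega) (not_lt.1 hcon)
        omega
      have h8 : ((2 * w.length + 4 : ℕ) : ℤ) * 1 ≤
          ((2 * w.length + 4 : ℕ) : ℤ) * (r / (2 * w.length + 4 : ℕ)) :=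
        mul_le_mul_of_nonneg_left h7 (by omega)
      have h9 : S.rounds = 2 * w.length + 4 := rfl
      omega
    have h6 := S.time_periodic M
    rcases h5.eq_or_lt with h5 | h5
    · rw [← h5] at hrk
      omega
    · have := S.time_add_le h5
      omega

/-- A cycle has an even number of rounds with odd flight times, so its length is even and is not
doubled. -/
theorem chamberLength_wordSchedule (hn : 0 < n) :
    (wordSchedule n w).pattern.chamberLength = (wordSchedule n w).length := by
  have h1 := (wordSchedule n w).time_periodic 0
  have h2 := (wordSchedule n w).even_time (0 + (wordSchedule n w).rounds)
  have h3 := (wordSchedule n w).even_time 0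
  have h4 : Even (((wordSchedule n w).rounds : ℕ) : ℤ) :=
    ⟨((w.length + 2 : ℕ) : ℤ), by change ((2 * w.length + 4 : ℕ) : ℤ) = _; push_cast; ring⟩
  rw [h1, zero_add, Int.even_add, h3] at h2
  have h5 : Even (wordSchedule n w).length := by
    have : Even (((wordSchedule n w).length : ℕ) : ℤ) := by simpa [h4] using h2
    exact_mod_cast this
  rw [JugglingPattern.chamberLength, exactPeriod_wordSchedule hn,
    if_neg (Nat.not_odd_iff_even.2 h5)]

open JugglingPattern in
theorem closedBraid_wordSchedule (hn : 0 < n) {c d : ℝ} (hs : (wordSchedule n w).IsSmall c d) :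
    (wordSchedule n w).pattern.closedBraid c d = ⟨n, ConjClasses.mk (braidOfWord n w)⟩ := by
  obtain ⟨F, hF, hF'⟩ := exists_braidAtTimes hs (2 * w.length + 4)
  have ht0 : (wordSchedule n w).time 0 = -(2 * n) := by
    change cyclicSum _ _ 0 - 2 * n = _
    rw [cyclicSum_zero]
    ring
  have ht1 : (wordSchedule n w).time ((2 * w.length + 4 : ℕ) : ℤ) =
      (wordSchedule n w).length - 2 * n := by
    have := (wordSchedule n w).time_periodic 0
    rw [zero_add, ht0] at this
    change (wordSchedule n w).time ((wordSchedule n w).rounds : ℤ) = _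
    rw [this]
    ring
  have hct : (wordSchedule n w).pattern.crossingTimes c d = (F : Set ℝ) := by
    ext t
    rw [Finset.mem_coe, hF, crossingTimes, chamberLength_wordSchedule hn, ht0, ht1]
    push_cast
    rw [neg_add_cancel, sub_add_cancel, Set.mem_Ico, and_assoc]
    rfl
  have hw : braidOfWord (Nat.card (wordSchedule n w).pattern.Ball)
      ((wordSchedule n w).pattern.chamberWord c d) =
      (wordSchedule n w).pattern.braidAtTimes c d F := by
    have hfin : ((wordSchedule n w).pattern.crossingTimes c d).Finite := by
      rw [hct]; exact F.finite_toSet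
    rw [chamberWord, dif_pos hfin, braidAtTimes]
    have : hfin.toFinset = F := by
      rw [← Finset.coe_inj, hfin.coe_toFinset, hct]
    rw [this]
  -- The number of strands is `Nat.card` of the balls, equal to `n` only propositionally. It can be
  -- rewritten because `midBraid` and `turnBraid` take it as a separate parameter.
  rw [closedBraid, hw, hF', card_ball, prod_rounds]

/-! ### The theorem -/

theorem exists_braidOfWord_eq (n : ℕ) (g : BraidGroup n) : ∃ w, braidOfWord n w = g := by
  obtain ⟨g, rfl⟩ := PresentedGroup.mk_surjective _ g
  induction g using FreeGroup.induction_on with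
  | C1 => exact ⟨[], by simp⟩
  | of i => exact ⟨[(i, true)], by simp [braidLetter, braidGen]; rfl⟩
  | inv_of i _ => exact ⟨[(i, false)], by simp [braidLetter, braidGen]; rfl⟩
  | mul x y hx hy =>
    obtain ⟨v, hv⟩ := hx
    obtain ⟨w, hw⟩ := hy
    exact ⟨v ++ w, by rw [braidOfWord_append, hv, hw, map_mul]⟩

theorem jMapsTo_wordSchedule (hn : 0 < n) :
    (wordSchedule n w).pattern.JMapsTo ⟨n, ConjClasses.mk (braidOfWord n w)⟩ := by
  have hb : (0 : ℝ) < 8 * (((wordSchedule n w).bound : ℝ) + 4) ^ 2 := by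
    have := eight_le_bound (S := wordSchedule n w)
    positivity
  refine ⟨min (1 / 2) (1 / (8 * (((wordSchedule n w).bound : ℝ) + 4) ^ 2)),
    lt_min (by norm_num) (by positivity), fun c d hc hc' hd hd' => ?_⟩
  have hs : (wordSchedule n w).IsSmall c d :=
    ⟨hc, hd, (hd'.trans_le (min_le_left _ _)).le, by
      have := (hc'.trans_le (min_le_right _ _)).le
      rwa [le_div_iff₀ hb] at this⟩
  exact ⟨collisionFree hs, closedBraid_wordSchedule hn hs⟩

/-- The pattern without balls. -/
def emptyPattern : JugglingPattern where
  f := 1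
  le_apply _ := le_rfl
  periodic := ⟨1, one_pos, fun t => by simp⟩

instance : IsEmpty emptyPattern.Ball := ⟨fun b => b.2.elim fun _ h => h.1 rfl⟩

theorem subsingleton_solidTorusBraid_zero (x y : ConjClasses (BraidGroup 0)) : x = y := by
  have : Subsingleton (BraidGroup 0) := by
    refine ⟨fun g h => ?_⟩
    obtain ⟨g, rfl⟩ := PresentedGroup.mk_surjective _ g
    obtain ⟨h, rfl⟩ := PresentedGroup.mk_surjective _ h
    have : IsEmpty (Fin (0 - 1)) := inferInstanceAs (IsEmpty (Fin 0))
    rw [Subsingleton.elim g h]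
  obtain ⟨g, rfl⟩ := ConjClasses.mk_surjective x
  obtain ⟨h, rfl⟩ := ConjClasses.mk_surjective y
  rw [Subsingleton.elim g h]

theorem jMapsTo_emptyPattern (x : ConjClasses (BraidGroup 0)) : emptyPattern.JMapsTo ⟨0, x⟩ := by
  refine ⟨1, one_pos, fun c d _ _ _ _ => ⟨fun _ a => isEmptyElim a, ?_⟩⟩
  have h : Nat.card emptyPattern.Ball = 0 := Nat.card_of_isEmpty
  unfold JugglingPattern.closedBraid
  generalize ConjClasses.mk (braidOfWord (Nat.card emptyPattern.Ball) _) = y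
  generalize Nat.card emptyPattern.Ball = N at *
  subst h
  rw [subsingleton_solidTorusBraid_zero y x]

theorem theorem5 (β : SolidTorusBraid) : ∃ P : JugglingPattern, P.JMapsTo β := by
  obtain ⟨n, x⟩ := β
  -- Without balls there is no greatest throw to fix the period; but the braid group on no strands
  -- is trivial.
  rcases Nat.eq_zero_or_pos n with rfl | hn
  · exact ⟨emptyPattern, jMapsTo_emptyPattern x⟩
  · obtain ⟨g, rfl⟩ := ConjClasses.mk_surjective x
    obtain ⟨w, rfl⟩ := exists_braidOfWord_eq n g
    exact ⟨(wordSchedule n w).pattern, jMapsTo_wordSchedule hn⟩
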